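/- A \emph{Nelson algebra} is an algebra $(N,1,\sim,\wedge,\vee,\to)$ of type $(0,1,2,2,2)$ satisfying $x\wedge(x\vee y)=x$; $x\wedge(y\vee z)=(z\wedge x)\vee(y\wedge x)$; $\sim\sim x=x$; $\sim(x\vee y)=\sim x\wedge\sim y$; $x\wedge\sim x=(x\wedge\sim x)\wedge(y\vee\sim y)$; $x\to x=1$; $x\to(y\to z)=(x\wedge y)\to z$; $x\wedge(x\to y)=x\wedge(\sim x\vee y)$. It is \emph{five-valued} if also $((x\to z)\to y)\to(((y\to x)\to y)\to y)=1$. The chain $C_5=\{0,\frac14,\frac12,\frac34,1\}$ is a five-valued Nelson algebra with $\wedge=\min$, $\vee=\max$, $\sim x=1-x$, and $x\to y=1$ if $x\le y$ or $x\le\sim x$, $x\to y=\sim x\vee y$ otherwise. A subset $G$ of a five-valued Nelson algebra $F$ is a \emph{set of free generators} of $F$ if it generates $F$ and every map from $G$ to a five-valued Nelson algebra extends to a unique homomorphism on $F$. For a Nelson algebra $N$ let $X(N)$ be the set of its prime lattice filters, ordered by inclusion, with the order-reversing involution $\varphi(P)=N\setminus\{\sim x: x\in P\}$. For a connected component $C$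 of this poset (it is closed under $\varphi$), let $D(C)$ be the set of upward closed subsets of $C$ with the operations $1=C$, $\sim U=C\setminus\varphi(U)$, $\cap$, $\cup$, and $U\to V=C\setminus(U\cap\varphi(U)\cap(C\setminus V)]$, where $(Y]$ is the downward closed set generated by $Y$ in $C$. Let $n\ge 1$. There is a five-valued Nelson algebra with a set of $n$ free generators. Let $F(n)$ be any such algebra, with set of free generators $G$, $|G|=n$. For $f:G\to\{0,\frac12,1\}\subseteq C_5$ let $\bar f:F(n)\to C_5$ be the homomorphism extending $f$, let $P_f=\bar f^{-1}(1)\in X(F(n))$, and let $C_f$ be the connected component of $P_f$ in $X(F(n))$. Then: (1) Every point of $X(F(n))$ lies in $C_f$ for exactly one $f\in\{0,\frac12,1\}^G$. (2) Each $D(C_f)$ is a five-valued Nelson algebra, and $F(n)\cong\prod_{f\in\{0,\frac12,1\}^G}D(C_f)$ as Nelson algebras. (3) If $f$ takes values in $\{0,1\}$, then $|D(C_f)|=2^{2^n}$. (4) If $f$ takes the value $\frac12$ at exactly $k\ge1$ generators, then $|D(C_f)|=2^{2^{n-k}}+1$. (5) $F(n)$ is finite and $$|F(n)|=2^{2^{2n}}\cdot\prod_{k=1}^{n}\left(2^{2^{n-k}}+1\right)^{\binom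 nk 2^{n-k}}.$$ -/

import Mathlib

universe u v

/-- An algebra `(N, 1, ∼, ⋏, ⋎, ⇾)` of type `(0, 1, 2, 2, 2)`: the signature of Nelson algebras,
without any law. -/
class NelsonOps (N : Type u) where
  one : N
  neg : N → N
  inf : N → N → N
  sup : N → N → N
  imp : N → N → N

prefix:max "∼" => NelsonOps.neg
infixl:70 " ⋏ " => NelsonOps.inf
infixl:65 " ⋎ " => NelsonOps.sup
infixr:60 " ⇾ " => NelsonOps.imp

/-- Nelson algebras, by the equations of A. and L. Monteiro. -/
class IsNelsonAlgebra (N : Type u) [NelsonOps N] : Prop where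
  inf_sup_self : ∀ x y : N, x ⋏ (x ⋎ y) = x
  inf_sup : ∀ x y z : N, x ⋏ (y ⋎ z) = (z ⋏ x) ⋎ (y ⋏ x)
  neg_neg : ∀ x : N, ∼(∼x) = x
  neg_sup : ∀ x y : N, ∼(x ⋎ y) = ∼x ⋏ ∼y
  kleene : ∀ x y : N, x ⋏ ∼x = (x ⋏ ∼x) ⋏ (y ⋎ ∼y)
  imp_self : ∀ x : N, x ⇾ x = NelsonOps.one
  imp_imp : ∀ x y z : N, x ⇾ (y ⇾ z) = (x ⋏ y) ⇾ z
  inf_imp : ∀ x y : N, x ⋏ (x ⇾ y) = x ⋏ (∼x ⋎ y)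

/-- Five-valued Nelson algebras. -/
class IsFiveValuedNelson (N : Type u) [NelsonOps N] : Prop extends IsNelsonAlgebra N where
  five_valued : ∀ x y z : N,
    ((x ⇾ z) ⇾ y) ⇾ (((y ⇾ x) ⇾ y) ⇾ y) = NelsonOps.one

/-- Homomorphisms of algebras of this signature. -/
structure IsNelsonHom {M : Type u} {N : Type v} [NelsonOps M] [NelsonOps N] (h : M → N) :
    Prop where
  map_one : h NelsonOps.one = NelsonOps.one
  map_neg : ∀ x, h (∼x) = ∼(h x)
  map_inf : ∀ x y, h (x ⋏ y) = h x ⋏ h y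
  map_sup : ∀ x y, h (x ⋎ y) = h x ⋎ h y
  map_imp : ∀ x y, h (x ⇾ y) = h x ⇾ h y

/-- Products, with the operations defined pointwise. -/
instance NelsonOps.pi {ι : Type u} {N : ι → Type v} [∀ i, NelsonOps (N i)] :
    NelsonOps (∀ i, N i) where
  one := fun _ => NelsonOps.one
  neg := fun x i => ∼(x i)
  inf := fun x y i => x i ⋏ y i
  sup := fun x y i => x i ⋎ y i
  imp := fun x y i => x i ⇾ y i

/-- Subalgebras, as sets closed under the operations. -/
structure IsNelsonSubalgebra {N : Type u} [NelsonOps N] (S : Set N) : Prop where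
  one_mem : NelsonOps.one ∈ S
  neg_mem : ∀ x ∈ S, ∼x ∈ S
  inf_mem : ∀ x ∈ S, ∀ y ∈ S, x ⋏ y ∈ S
  sup_mem : ∀ x ∈ S, ∀ y ∈ S, x ⋎ y ∈ S
  imp_mem : ∀ x ∈ S, ∀ y ∈ S, x ⇾ y ∈ S

/-- `G` is a set of free generators of the five-valued Nelson algebra `F`: it generates `F`, and
every map from `G` to a five-valued Nelson algebra extends to a unique homomorphism on `F`. -/
structure IsFreeGeneratingSet {F : Type u} [NelsonOps F] [IsFiveValuedNelson F] (G : Set F) :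
    Prop where
  generates : ∀ S : Set F, IsNelsonSubalgebra S → G ⊆ S → S = Set.univ
  lift : ∀ (N : Type u) [NelsonOps N] [IsFiveValuedNelson N] (f : G → N),
    ∃! h : F → N, IsNelsonHom h ∧ ∀ g : G, h g = f g

/-! ### The five-element chain -/

/-- The chain `C₅ = {0, 1/4, 1/2, 3/4, 1}`; `⟨j⟩` stands for `j / 4`. -/
structure C5 : Type u where
  num : Fin 5

namespace C5

def zero : C5.{u} := ⟨0⟩
def half : C5.{u} := ⟨2⟩
def one : C5.{u} := ⟨4⟩

/-- `∼x = 1 - x`; `x ⇾ y` is `1` if `x ≤ y` or `x ≤ ∼x`, and `∼x ⋎ y` otherwise. -/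
instance : NelsonOps C5.{u} where
  one := one
  neg := fun x => ⟨x.num.rev⟩
  inf := fun x y => ⟨min x.num y.num⟩
  sup := fun x y => ⟨max x.num y.num⟩
  imp := fun x y =>
    if x.num ≤ y.num ∨ x.num ≤ x.num.rev then one else ⟨max x.num.rev y.num⟩

theorem ext_num {x y : C5.{u}} (h : x.num = y.num) : x = y := by
  cases x; cases y; cases h; rfl

theorem num_imp (x y : C5.{u}) : (x ⇾ y).num =
    if x.num ≤ y.num ∨ x.num ≤ x.num.rev then 4 else max x.num.rev y.num := by
  change (if _ then _ else _ : C5.{u}).num = _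
  split_ifs <;> rfl

theorem num_one : (NelsonOps.one : C5.{u}).num = 4 := rfl
theorem num_neg (x : C5.{u}) : (∼x).num = x.num.rev := rfl
theorem num_inf (x y : C5.{u}) : (x ⋏ y).num = min x.num y.num := rfl
theorem num_sup (x y : C5.{u}) : (x ⋎ y).num = max x.num y.num := rfl

instance : IsFiveValuedNelson C5.{u} where
  inf_sup_self := fun ⟨x⟩ ⟨y⟩ => ext_num (by
    simp only [num_inf, num_sup]; revert x y; decide)
  inf_sup := fun ⟨x⟩ ⟨y⟩ ⟨z⟩ => ext_num (by
    simp only [num_inf, num_sup]; revert x y z; decide)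
  neg_neg := fun ⟨x⟩ => ext_num (by
    simp only [num_neg]; revert x; decide)
  neg_sup := fun ⟨x⟩ ⟨y⟩ => ext_num (by
    simp only [num_inf, num_sup, num_neg]; revert x y; decide)
  kleene := fun ⟨x⟩ ⟨y⟩ => ext_num (by
    simp only [num_inf, num_sup, num_neg]; revert x y; decide)
  imp_self := fun ⟨x⟩ => ext_num (by
    simp only [num_imp, num_one]; revert x; decide)
  imp_imp := fun ⟨x⟩ ⟨y⟩ ⟨z⟩ => ext_num (by
    simp only [num_imp, num_inf]; revert x y z; decide)
  inf_imp := fun ⟨x⟩ ⟨y⟩ => ext_num (by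
    simp only [num_imp, num_inf, num_sup, num_neg]; revert x y; decide)
  five_valued := fun ⟨x⟩ ⟨y⟩ ⟨z⟩ => ext_num (by
    simp only [num_imp, num_one]; revert x y z; decide)

end C5

/-! ### Elementary arithmetic of Nelson algebras -/

namespace IsNelsonAlgebra

variable {N : Type u} [NelsonOps N] [IsNelsonAlgebra N]

theorem inf_idem (x : N) : x ⋏ x = x := by
  have h1 : (x ⋏ x) ⋎ (x ⋏ x) = x := by rw [← inf_sup, inf_sup_self]
  have h2 : (x ⋏ x) ⋏ x = x ⋏ x := by
    have := inf_sup_self (x ⋏ x) (x ⋏ x)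
    rwa [h1] at this
  have h3 := inf_sup x (x ⋏ x) (x ⋏ x)
  rwa [h1, h2, h1] at h3

theorem sup_idem (x : N) : x ⋎ x = x := by
  have h1 : (x ⋏ x) ⋎ (x ⋏ x) = x := by rw [← inf_sup, inf_sup_self]
  rwa [inf_idem] at h1

theorem inf_comm (x y : N) : x ⋏ y = y ⋏ x := by
  have h := inf_sup x y y
  rwa [sup_idem, sup_idem] at h

theorem inf_sup_absorb (x y : N) : (x ⋏ y) ⋎ y = y := by
  have h := inf_sup y y x
  rw [inf_sup_self, inf_idem] at h
  exact h.symm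

theorem sup_inf_absorb (x y : N) : y ⋎ (x ⋏ y) = y := by
  have h1 : (x ⋏ y) ⋏ y = x ⋏ y := by
    have := inf_sup_self (x ⋏ y) y
    rwa [inf_sup_absorb] at this
  have h2 : (x ⋏ y) ⋏ (y ⋎ (x ⋏ y)) = x ⋏ y := by
    rw [inf_sup, inf_idem, inf_comm y, h1, sup_idem]
  have h3 := inf_sup (y ⋎ (x ⋏ y)) y (x ⋏ y)
  rw [inf_idem, h2, inf_sup_self, inf_sup_absorb] at h3
  exact h3

theorem neg_inf (x y : N) : ∼(x ⋏ y) = ∼x ⋎ ∼y := by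
  rw [← neg_neg (∼x ⋎ ∼y), neg_sup, neg_neg, neg_neg]

theorem inf_one (x : N) : x ⋏ NelsonOps.one = x := by
  have hc : ∼x ⋎ x = x ⋎ ∼x := by
    rw [← neg_neg (∼x ⋎ x), neg_sup, neg_neg, inf_comm, neg_inf, neg_neg]
  rw [← imp_self x, inf_imp, hc, inf_sup_self]

theorem zero_inf (x : N) : ∼NelsonOps.one ⋏ x = ∼NelsonOps.one := by
  have h : ∼NelsonOps.one ⋎ x = x := by
    rw [← neg_neg (∼NelsonOps.one ⋎ x), neg_sup, neg_neg, inf_comm, inf_one, neg_neg]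
  have h2 := inf_sup_self (∼NelsonOps.one) x
  rwa [h] at h2

/-- The negation reverses the order `x ≤ y ↔ x ⋏ y = x`. -/
theorem neg_anti {x y : N} (h : x ⋏ y = x) : ∼y ⋏ ∼x = ∼y := by
  rw [← neg_sup]
  conv_lhs => rw [← h]
  rw [sup_inf_absorb]

end IsNelsonAlgebra

/-! ### The space of prime filters -/

/-- Prime filters of the underlying lattice, whose order is `x ≤ y ↔ x ⋏ y = x`. -/
@[ext]
structure PrimeFilter (N : Type u) [NelsonOps N] : Type u where
  carrier : Set N
  one_mem : NelsonOps.one ∈ carrier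
  ne_univ : carrier ≠ Set.univ
  inf_mem : ∀ x ∈ carrier, ∀ y ∈ carrier, x ⋏ y ∈ carrier
  mem_of_le : ∀ x ∈ carrier, ∀ y, x ⋏ y = x → y ∈ carrier
  prime : ∀ x y, x ⋎ y ∈ carrier → x ∈ carrier ∨ y ∈ carrier

/-- Prime filters are ordered by inclusion. -/
instance PrimeFilter.instPartialOrder (N : Type u) [NelsonOps N] :
    PartialOrder (PrimeFilter N) :=
  PartialOrder.lift PrimeFilter.carrier fun _ _ h => PrimeFilter.ext h

/-- A partially ordered set with an order reversing involution `φ` such that every point is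
comparable with its image. -/
class InvolutivePoset (X : Type u) extends PartialOrder X where
  φ : X → X
  φ_φ : ∀ x, φ (φ x) = x
  φ_anti : ∀ x y, x ≤ y → φ y ≤ φ x
  comparable : ∀ x, x ≤ φ x ∨ φ x ≤ x

namespace PrimeFilter

variable {N : Type u} [NelsonOps N] [IsNelsonAlgebra N]

theorem zero_notMem (P : PrimeFilter N) : ∼NelsonOps.one ∉ P.carrier := fun h =>
  P.ne_univ (Set.eq_univ_of_forall fun x => P.mem_of_le _ h x (IsNelsonAlgebra.zero_inf x))

/-- The Białynicki-Birula–Rasiowa involution: `φ P` is the complement of `{∼x | x ∈ P}`, that is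
`{x | ∼x ∉ P}`. -/
def involution (P : PrimeFilter N) : PrimeFilter N where
  carrier := {x | ∼x ∉ P.carrier}
  one_mem := P.zero_notMem
  ne_univ := fun h => by
    have h1 : ∼NelsonOps.one ∈ {x : N | ∼x ∉ P.carrier} := by rw [h]; trivial
    exact h1 (by rw [IsNelsonAlgebra.neg_neg]; exact P.one_mem)
  inf_mem := fun x hx y hy h => by
    rw [IsNelsonAlgebra.neg_inf] at h
    exact (P.prime _ _ h).elim hx hy
  mem_of_le := fun x hx y h hy => hx (P.mem_of_le _ hy _ (IsNelsonAlgebra.neg_anti h))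
  prime := fun x y h => by
    by_contra hc
    simp only [Set.mem_ofPred_eq, not_or, not_not] at hc
    refine h ?_
    rw [IsNelsonAlgebra.neg_sup]
    exact P.inf_mem _ hc.1 _ hc.2

instance : InvolutivePoset (PrimeFilter N) where
  φ := involution
  φ_φ := fun P => PrimeFilter.ext (by
    ext x
    change ¬ (∼(∼x) ∉ P.carrier) ↔ _
    rw [IsNelsonAlgebra.neg_neg, not_not])
  φ_anti := fun P Q h x hx hP => hx (h hP)
  comparable := fun P => by
    by_contra hc
    rw [not_or] at hc
    obtain ⟨a, ha, ha'⟩ := Set.not_subset.1 hc.1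
    obtain ⟨b, hb, hb'⟩ := Set.not_subset.1 hc.2
    have h1 : ∼a ∈ P.carrier := not_not.1 ha'
    have h2 := P.mem_of_le _ (P.inf_mem _ ha _ h1) _ (IsNelsonAlgebra.kleene a b).symm
    exact (P.prime _ _ h2).elim hb' hb

/-- The kernel `{x | h x = 1}` of a homomorphism into `C₅`, as a prime filter. -/
def ker (h : N → C5.{u}) (hh : IsNelsonHom h) : PrimeFilter N where
  carrier := {x | h x = NelsonOps.one}
  one_mem := hh.map_one
  ne_univ := fun hu => by
    have h1 : ∼NelsonOps.one ∈ {x : N | h x = NelsonOps.one} := by rw [hu]; trivial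
    have h2 : h (∼NelsonOps.one) = NelsonOps.one := h1
    rw [hh.map_neg, hh.map_one] at h2
    exact absurd (congrArg C5.num h2) (by decide)
  inf_mem := fun x hx y hy => by
    change h (x ⋏ y) = _
    rw [hh.map_inf, hx, hy, IsNelsonAlgebra.inf_idem]
  mem_of_le := fun x hx y hxy => by
    have h1 := hh.map_inf x y
    rw [hxy, hx, IsNelsonAlgebra.inf_comm, IsNelsonAlgebra.inf_one] at h1
    exact h1.symm
  prime := fun x y hxy => by
    have h1 : h (x ⋎ y) = NelsonOps.one := hxy
    rw [hh.map_sup] at h1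
    rcases max_choice (h x).num (h y).num with h2 | h2
    · exact Or.inl (C5.ext_num (h2.symm.trans (congrArg C5.num h1)))
    · exact Or.inr (C5.ext_num (h2.symm.trans (congrArg C5.num h1)))

end PrimeFilter

/-! ### Connected components and the algebra of a space -/

/-- The connected component of `x` in the poset `X`: the points that can be joined to `x` by a
finite sequence of successively comparable points. -/
def Component {X : Type u} [PartialOrder X] (x : X) : Type u :=
  {y : X // Relation.EqvGen (· ≤ ·) x y}

theorem Component.eqvGen_φ {X : Type u} [InvolutivePoset X] (x : X) :
    Relation.EqvGen (· ≤ ·) x (InvolutivePoset.φ x) :=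
  (InvolutivePoset.comparable x).elim (fun h => .rel _ _ h) fun h => .symm _ _ (.rel _ _ h)

/-- A connected component, with the induced order and involution. -/
instance Component.instInvolutivePoset {X : Type u} [InvolutivePoset X] (x : X) :
    InvolutivePoset (Component x) where
  toPartialOrder := inferInstanceAs (PartialOrder {y : X // Relation.EqvGen (· ≤ ·) x y})
  φ := fun y => ⟨InvolutivePoset.φ y.1, .trans _ _ _ y.2 (Component.eqvGen_φ y.1)⟩
  φ_φ := fun y => Subtype.ext (InvolutivePoset.φ_φ y.1)
  φ_anti := fun y z h => InvolutivePoset.φ_anti y.1 z.1 h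
  comparable := fun y => InvolutivePoset.comparable y.1

/-- The upward closed subsets of `X`. -/
def UpSets (X : Type u) [InvolutivePoset X] : Type u := {U : Set X // IsUpperSet U}

/-- The algebra of upward closed subsets of `X`: `1 = X`, `∼U = X \ φ(U)`, intersection, union,
and `U ⇾ V = X \ (U ∩ φ(U) ∩ (X \ V)]`, where `(Y]` is the downward closed set generated
by `Y`. -/
instance UpSets.instNelsonOps (X : Type u) [InvolutivePoset X] : NelsonOps (UpSets X) where
  one := ⟨Set.univ, isUpperSet_univ⟩
  neg := fun U => ⟨(InvolutivePoset.φ '' U.1)ᶜ, by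
    rintro x y hxy hx ⟨z, hz, rfl⟩
    refine hx ⟨InvolutivePoset.φ x, U.2 ?_ hz, InvolutivePoset.φ_φ x⟩
    have := InvolutivePoset.φ_anti _ _ hxy
    rwa [InvolutivePoset.φ_φ] at this⟩
  inf := fun U V => ⟨U.1 ∩ V.1, U.2.inter V.2⟩
  sup := fun U V => ⟨U.1 ∪ V.1, U.2.union V.2⟩
  imp := fun U V =>
    ⟨(lowerClosure (U.1 ∩ InvolutivePoset.φ '' U.1 ∩ V.1ᶜ) : Set X)ᶜ,
      (lowerClosure (U.1 ∩ InvolutivePoset.φ '' U.1 ∩ V.1ᶜ)).lower.compl⟩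

/-! ### The factors of the free algebra -/

/-- The functions from `G` to `{0, 1/2, 1} ⊆ C₅`. -/
def ThreeValuedFun {F : Type u} (G : Set F) : Type u :=
  {f : G → C5.{u} // ∀ g, f g = C5.zero ∨ f g = C5.half ∨ f g = C5.one}

/-- The number of generators at which `f` takes the value `1/2`. -/
noncomputable def ThreeValuedFun.halves {F : Type u} {G : Set F} (f : ThreeValuedFun G) : ℕ :=
  Nat.card {g : G // f.1 g = C5.half}

namespace IsFreeGeneratingSet

variable {F : Type u} [NelsonOps F] [IsFiveValuedNelson F] {G : Set F}

/-- The unique homomorphism `F → C₅` that extends `f : G → C₅`. -/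
noncomputable def extend (hG : IsFreeGeneratingSet G) (f : G → C5.{u}) : F → C5.{u} :=
  (hG.lift C5.{u} f).choose

theorem isNelsonHom_extend (hG : IsFreeGeneratingSet G) (f : G → C5.{u}) :
    IsNelsonHom (hG.extend f) :=
  (hG.lift C5.{u} f).choose_spec.1.1

/-- The prime filter `P_f`, the kernel of the homomorphism that extends `f`. -/
noncomputable def kerFilter (hG : IsFreeGeneratingSet G) (f : G → C5.{u}) : PrimeFilter F :=
  PrimeFilter.ker (hG.extend f) (hG.isNelsonHom_extend f)

/-- The factor coming from `f`: the algebra of the connected component of `P_f` in the space of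
prime filters of `F`. -/
abbrev Factor (hG : IsFreeGeneratingSet G) (f : ThreeValuedFun G) : Type u :=
  UpSets (Component (hG.kerFilter f.1))

end IsFreeGeneratingSet

/-!
A five-valued Nelson algebra is controlled by its homomorphisms into `C₅`. For a prime filter `P`
with `P ≤ φ P`, the relation `x ⇾ y ∈ P` behaves like an intuitionistic implication, and the
five-valued axiom says that the Kripke frame above `P` has at most two worlds: `P` itself and the
set `summit P` of the elements not refuted in `P` (`PrimeFilter.imp_mem_iff`). Counting the
members of the chain `P ≤ summit P ≤ φ (summit P) ≤ φ P` that contain a given element is then a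
homomorphism into `C₅` with kernel `P` (`PrimeFilter.isNelsonHom_valuation`). As every prime
filter is comparable with its image, each one is the kernel of a homomorphism into `C₅` or the
image of such a kernel (`PrimeFilter.exists_ker_eq_or`), and homomorphisms into `C₅` separate
points. Hence terms modulo the equations of `C₅` form a free algebra.

In a free algebra over `G` the homomorphisms into `C₅` are the functions `G → C₅`. Composing with
the retraction of `C₅` onto `{0, 1/2, 1}` enlarges kernels, so every prime filter is connected to
some `P_f` with `f` three-valued. Conversely, the complemented elements `¬¬x`, for the weak negation
`¬x = x ⇾ 0`, are constant on connected components and determine `f`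
(`IsFreeGeneratingSet.existsUnique_eqvGen`). There are finitely many prime filters, so every
upward closed set of them comes from an element, and the algebra is the product of the algebras
of its components (`IsFreeGeneratingSet.bijective_toFactors`). These factors are homomorphic
images of the free algebra, which is why they are five-valued Nelson algebras.

The component of `P_f` consists of the kernels of the `2 ^ (n - k)` functions that retract to `f`,
where `k` is the number of values `1/2` of `f`, and of the images of these kernels. The kernels
other than `P_f` form an antichain below `P_f`, and their images an antichain above `φ P_f`.
Moreover `P_f = φ P_f` exactly when `k = 0`. Counting the upward closed sets of such a poset
(`UpSets.card_of_antichain`) gives the cardinalities.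
-/

/-! ### Lattice order and weak implication -/

namespace IsNelsonAlgebra

section Lattice

variable {N : Type u} [NelsonOps N] [IsNelsonAlgebra N]

theorem sup_comm (x y : N) : x ⋎ y = y ⋎ x := by
  rw [← neg_neg (x ⋎ y), neg_sup, inf_comm, neg_inf, neg_neg, neg_neg]

/-- The underlying distributive lattice, ordered by `x ≤ y ↔ x ⋏ y = x`. -/
abbrev distribLattice (N : Type u) [NelsonOps N] [IsNelsonAlgebra N] : DistribLattice N :=
  letI : Lattice N :=
    { le := fun x y => x ⋏ y = x
      inf := fun x y => x ⋏ y
      sup := fun x y => x ⋎ y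
      le_refl := inf_idem
      le_antisymm := fun x y h h' => by rw [← h, inf_comm, h']
      le_trans := fun x y z h h' => by
        have h1 : z ⋎ y = z := by conv_lhs => rw [← h', sup_inf_absorb]
        rw [← h1, inf_sup, inf_comm y x, h, sup_inf_absorb]
      inf_le_right := fun x y => by
        have := inf_sup_self (x ⋏ y) y
        rwa [inf_sup_absorb] at this
      inf_le_left := fun x y => by
        rw [inf_comm x y]
        have := inf_sup_self (y ⋏ x) x
        rwa [inf_sup_absorb] at this
      le_inf := fun z x y h h' => by
        have h1 : y ⋎ z = y := by conv_lhs => rw [← h', sup_inf_absorb]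
        have h2 : x ⋏ y = z ⋎ (y ⋏ x) := by
          conv_lhs => rw [← h1, inf_sup, h]
        rw [h2, inf_sup_self]
      le_sup_left := inf_sup_self
      le_sup_right := fun x y => by rw [sup_comm, inf_sup_self]
      sup_le := fun x y z h h' => by
        rw [inf_comm, inf_sup, h, h', sup_comm] }
  DistribLattice.ofInfSupLe (fun x y z => by
      change (x ⋏ (y ⋎ z)) ⋏ ((x ⋏ y) ⋎ (x ⋏ z)) = x ⋏ (y ⋎ z)
      have h : x ⋏ (y ⋎ z) = (x ⋏ y) ⋎ (x ⋏ z) := by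
        rw [inf_sup, sup_comm, inf_comm z, inf_comm y]
      rw [← h, inf_idem])

attribute [local instance] distribLattice

theorem inf_eq (x y : N) : x ⋏ y = x ⊓ y := rfl
theorem sup_eq (x y : N) : x ⋎ y = x ⊔ y := rfl

theorem le_one (x : N) : x ≤ NelsonOps.one := inf_one x
theorem zero_le (x : N) : ∼NelsonOps.one ≤ x := zero_inf x

theorem neg_le_neg {x y : N} (h : x ≤ y) : ∼y ≤ ∼x := neg_anti h

theorem inf_neg_le (x y : N) : x ⊓ ∼x ≤ y ⊔ ∼y :=
  inf_eq_left.1 (kleene x y).symm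

theorem imp_one (x : N) : x ⇾ NelsonOps.one = NelsonOps.one := by
  rw [← imp_self x, imp_imp, inf_idem]

theorem imp_eq_one_of_le {x y : N} (h : x ≤ y) : x ⇾ y = NelsonOps.one := by
  have h' : x ⋏ y = x := h
  rw [← h', ← imp_imp, imp_self, imp_one]

/-- The relation `x ⇾ y = 1` is expressed by the lattice operations and the negation alone. -/
theorem imp_eq_one_iff {x y : N} : x ⇾ y = NelsonOps.one ↔ x ≤ ∼x ⊔ y := by
  constructor
  · intro h
    -- Both directions read off `x ⋏ (x ⇾ y) = x ⋏ (∼x ⋎ y)`.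
    have := inf_imp x y
    rw [h, inf_one] at this
    exact inf_eq_left.1 this.symm
  · intro h
    have h1 : x ⋏ (x ⇾ y) = x := (inf_imp x y).trans (inf_eq_left.2 h)
    have h2 := imp_eq_one_of_le (show x ≤ x ⇾ y from h1)
    rwa [imp_imp, inf_idem] at h2

theorem imp_eq_one_trans {x y z : N} (h : x ⇾ y = NelsonOps.one) (h' : y ⇾ z = NelsonOps.one) :
    x ⇾ z = NelsonOps.one := by
  rw [imp_eq_one_iff] at *
  -- The contrapositive of `x ≤ ∼x ⊔ y` disposes of the part of `x ⊓ y` below `∼y`.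
  have h1 : x ⊓ ∼y ≤ ∼x := by
    have := neg_le_neg h
    rwa [← sup_eq, neg_sup, neg_neg, inf_eq] at this
  calc x ≤ x ⊓ (∼x ⊔ y) := le_inf le_rfl h
    _ ≤ ∼x ⊔ x ⊓ y := by
      rw [inf_sup_left]; exact sup_le_sup inf_le_right le_rfl
    _ ≤ ∼x ⊔ x ⊓ (∼y ⊔ z) := sup_le_sup le_rfl (inf_le_inf le_rfl h')
    _ ≤ ∼x ⊔ z := by
      rw [inf_sup_left]
      exact sup_le le_sup_left (sup_le (h1.trans le_sup_left) (inf_le_right.trans le_sup_right))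

theorem sup_imp_eq_one {x y z : N} (h : x ⇾ z = NelsonOps.one) (h' : y ⇾ z = NelsonOps.one) :
    (x ⋎ y) ⇾ z = NelsonOps.one := by
  -- Kleene's inequality bounds `x ⊓ ∼x` by `y ⊔ ∼y`, which absorbs the cross terms.
  have key : ∀ {a b : N}, a ≤ ∼a ⊔ z → b ≤ ∼b ⊔ z → a ≤ ∼b ⊔ z := fun {a b} ha hb =>
    calc a ≤ a ⊓ (∼a ⊔ z) := le_inf le_rfl ha
      _ ≤ (b ⊔ ∼b) ⊔ z := by
        rw [inf_sup_left]; exact sup_le_sup (inf_neg_le a b) inf_le_right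
      _ ≤ ∼b ⊔ z := sup_le (sup_le hb le_sup_left) le_sup_right
  rw [imp_eq_one_iff] at *
  rw [neg_sup, sup_eq, inf_eq, sup_inf_right]
  exact sup_le (le_inf h (key h h')) (le_inf (key h' h) h')

theorem inf_neg_imp (x y : N) : (x ⋏ ∼x) ⇾ y = NelsonOps.one := by
  rw [imp_eq_one_iff, neg_inf, neg_neg, sup_eq, inf_eq]
  exact inf_le_left.trans (le_sup_right.trans le_sup_left)

theorem imp_imp_left (x y : N) : x ⇾ y ⇾ x = NelsonOps.one := by
  rw [imp_imp]; exact imp_eq_one_of_le inf_le_left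

/-- The prime ideal theorem, for filters. -/
theorem exists_primeFilter {x y : N} (h : ¬ x ≤ y) :
    ∃ P : PrimeFilter N, x ∈ P.carrier ∧ y ∉ P.carrier := by
  obtain ⟨J, hJ, hyJ, hd⟩ := DistribLattice.prime_ideal_of_disjoint_filter_ideal
    (F := Order.PFilter.principal x) (I := Order.Ideal.principal y) (by
      rw [Set.disjoint_left]
      intro z hz hz'
      exact h (le_trans (Order.PFilter.mem_principal.1 hz) (Order.Ideal.mem_principal.1 hz')))
  have hx : x ∉ J := Set.disjoint_left.1 hd (Order.PFilter.mem_principal.2 le_rfl)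
  have hy : y ∈ J := hyJ (Order.Ideal.mem_principal.2 le_rfl)
  refine ⟨⟨{z | z ∉ J}, ?_, ?_, ?_, ?_, ?_⟩, hx, not_not.2 hy⟩
  · exact fun h1 => hx (J.lower (le_one x) h1)
  · exact fun hu => (hu.symm ▸ Set.mem_univ y : y ∈ {z | z ∉ J}) hy
  · intro a ha b hb hab
    exact (hJ.mem_or_mem hab).elim ha hb
  · exact fun a ha b hab hb => ha (J.lower (show a ≤ b from hab) hb)
  · intro a b hab
    by_contra hc
    simp only [Set.mem_ofPred_eq, not_or, not_not] at hc
    exact hab (Order.Ideal.sup_mem hc.1 hc.2)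

theorem exists_primeFilter_of_ne {x y : N} (hxy : x ≠ y) :
    ∃ P : PrimeFilter N, ¬ (x ∈ P.carrier ↔ y ∈ P.carrier) := by
  by_cases h : x ≤ y
  · obtain ⟨P, h1, h2⟩ := exists_primeFilter fun h' => hxy (le_antisymm h h')
    exact ⟨P, fun h3 => h2 (h3.2 h1)⟩
  · obtain ⟨P, h1, h2⟩ := exists_primeFilter h
    exact ⟨P, fun h3 => h2 (h3.1 h1)⟩

end Lattice

/-! ### Deductive systems -/

/-- Deductive systems: sets that contain `1` and are closed under modus ponens. -/
structure IsDeductive {N : Type u} [NelsonOps N] (D : Set N) : Prop where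
  one_mem : NelsonOps.one ∈ D
  mp : ∀ {x y}, x ∈ D → x ⇾ y ∈ D → y ∈ D

namespace IsDeductive

theorem mem_of_imp_eq_one {N : Type u} [NelsonOps N] {D : Set N} (hD : IsDeductive D) {x y : N}
    (hx : x ∈ D) (h : x ⇾ y = NelsonOps.one) : y ∈ D :=
  hD.mp hx (h ▸ hD.one_mem)

variable {N : Type u} [NelsonOps N] [IsNelsonAlgebra N] {D : Set N} {x y z : N}

attribute [local instance] distribLattice

theorem inf_mem (hD : IsDeductive D) (hx : x ∈ D) (hy : y ∈ D) : x ⋏ y ∈ D :=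
  hD.mp hy (hD.mem_of_imp_eq_one hx (by rw [imp_imp, imp_self]))

theorem mem_of_le (hD : IsDeductive D) (hx : x ∈ D) (h : x ≤ y) : y ∈ D :=
  hD.mem_of_imp_eq_one hx (imp_eq_one_of_le h)

/-- The deductive system generated by `D` and one more element. -/
theorem adjoin (hD : IsDeductive D) (a : N) : IsDeductive {x | a ⇾ x ∈ D} where
  one_mem := by
    change a ⇾ _ ∈ D
    rw [imp_one]; exact hD.one_mem
  mp {x y} hx hxy := by
    refine hD.mp hx (hD.mp hxy ?_)
    have h1 : ∀ b c : N, (b ⇾ c) ⋏ b ⇾ c = NelsonOps.one := fun b c => by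
      rw [← imp_imp, imp_self]
    rw [imp_imp, imp_imp]
    convert hD.one_mem
    set t := ((a ⇾ x ⇾ y) ⋏ (a ⇾ x)) ⋏ a with ht
    have hmono : t ⇾ a ⋏ x = NelsonOps.one := by
      have h2 : t ⇾ x = NelsonOps.one :=
        imp_eq_one_trans (imp_eq_one_of_le (inf_le_inf inf_le_right le_rfl)) (h1 a x)
      have h3 : x ⇾ t ⇾ a ⋏ x = NelsonOps.one := by
        rw [imp_imp]
        exact imp_eq_one_of_le (le_inf (inf_le_right.trans inf_le_right) inf_le_left)
      have h4 := imp_eq_one_trans h2 h3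
      rwa [imp_imp, inf_idem] at h4
    have h5 : (a ⋏ x) ⇾ t ⇾ y = NelsonOps.one := by
      rw [imp_imp]
      refine imp_eq_one_trans (imp_eq_one_of_le ?_) (h1 (a ⋏ x) y)
      rw [← imp_imp]
      exact le_inf (inf_le_right.trans (inf_le_left.trans inf_le_left)) inf_le_left
    have h6 := imp_eq_one_trans hmono h5
    rwa [imp_imp, inf_idem] at h6

/-- The deduction theorem: to prove `x ⇾ y` in `D`, derive `y` from `x` in an arbitrary extension
of `D`. -/
theorem imp_mem (hD : IsDeductive D)
    (h : ∀ E : Set N, IsDeductive E → D ⊆ E → x ∈ E → y ∈ E) : x ⇾ y ∈ D :=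
  h _ (hD.adjoin x)
    (fun z hz => hD.mem_of_imp_eq_one hz (imp_imp_left z x)) (by
      change x ⇾ x ∈ D
      rw [imp_self]; exact hD.one_mem)

/-- Reasoning by cases, which rests on `sup_imp_eq_one`. -/
theorem sup_elim (hD : IsDeductive D) (h : x ⋎ y ∈ D) (hx : x ⇾ z ∈ D) (hy : y ⇾ z ∈ D) :
    z ∈ D := by
  refine hD.mp h (hD.mem_of_imp_eq_one (hD.inf_mem hx hy) ?_)
  have h1 : ∀ b c : N, (b ⇾ c) ⋏ b ⇾ c = NelsonOps.one := fun b c => by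
    rw [← imp_imp, imp_self]
  rw [imp_imp, inf_sup]
  refine sup_imp_eq_one (imp_eq_one_trans (imp_eq_one_of_le ?_) (h1 y z))
    (imp_eq_one_trans (imp_eq_one_of_le ?_) (h1 x z))
  · exact le_inf (inf_le_right.trans inf_le_right) inf_le_left
  · exact le_inf (inf_le_right.trans inf_le_left) inf_le_left

theorem mem_of_zero_mem (hD : IsDeductive D) (h : ∼NelsonOps.one ∈ D) (x : N) : x ∈ D :=
  hD.mem_of_le h (zero_le x)

end IsDeductive

end IsNelsonAlgebra

/-! ### Prime filters below their image under the involution -/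

namespace PrimeFilter

open InvolutivePoset

attribute [local instance] IsNelsonAlgebra.distribLattice

section Nelson

variable {N : Type u} [NelsonOps N] [IsNelsonAlgebra N] {P Q : PrimeFilter N} {x y : N}

theorem mem_φ : x ∈ (φ P).carrier ↔ ∼x ∉ P.carrier := Iff.rfl

theorem neg_mem_φ : ∼x ∈ (φ P).carrier ↔ x ∉ P.carrier := by
  rw [mem_φ, IsNelsonAlgebra.neg_neg]

theorem sup_mem_iff : x ⋎ y ∈ P.carrier ↔ x ∈ P.carrier ∨ y ∈ P.carrier :=
  ⟨P.prime x y, fun h => h.elim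
    (fun h => P.mem_of_le _ h _ (IsNelsonAlgebra.inf_sup_self x y))
    fun h => P.mem_of_le _ h _ (by
      rw [IsNelsonAlgebra.sup_comm]; exact IsNelsonAlgebra.inf_sup_self y x)⟩

theorem inf_mem_iff : x ⋏ y ∈ P.carrier ↔ x ∈ P.carrier ∧ y ∈ P.carrier :=
  ⟨fun h => ⟨P.mem_of_le _ h _ (show x ⊓ y ≤ x from inf_le_left),
    P.mem_of_le _ h _ (show x ⊓ y ≤ y from inf_le_right)⟩, fun h => P.inf_mem _ h.1 _ h.2⟩

/-- Modus ponens holds at `x` in `P` as soon as `x` belongs to both `P` and its image. -/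
theorem mem_of_imp_mem (hx : x ∈ P.carrier) (hx' : ∼x ∉ P.carrier) (h : x ⇾ y ∈ P.carrier) :
    y ∈ P.carrier := by
  have h1 := P.inf_mem _ hx _ h
  rw [IsNelsonAlgebra.inf_imp, inf_mem_iff, sup_mem_iff] at h1
  exact h1.2.resolve_left hx'

theorem isDeductive (hP : P ≤ φ P) : IsNelsonAlgebra.IsDeductive P.carrier where
  one_mem := P.one_mem
  mp hx h := mem_of_imp_mem hx (hP hx) h

/-- Below its image, a prime filter sees `∼(x ⇾ y)` as `x ⋏ ∼y`. -/
theorem neg_imp_mem_iff (hP : P ≤ φ P) :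
    ∼(x ⇾ y) ∈ P.carrier ↔ x ∈ P.carrier ∧ ∼y ∈ P.carrier := by
  constructor
  · intro h
    have hx : ∼x ∉ P.carrier := fun hx => by
      refine hP ((isDeductive hP).mem_of_imp_eq_one hx ?_) h
      rw [IsNelsonAlgebra.imp_imp, IsNelsonAlgebra.inf_comm, IsNelsonAlgebra.inf_neg_imp]
    have h1 : ∼(x ⋏ (x ⇾ y)) ∈ P.carrier := by
      rw [IsNelsonAlgebra.neg_inf, sup_mem_iff]; exact Or.inr h
    rw [IsNelsonAlgebra.inf_imp, IsNelsonAlgebra.neg_inf, sup_mem_iff, IsNelsonAlgebra.neg_sup,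
      IsNelsonAlgebra.neg_neg, inf_mem_iff] at h1
    exact h1.resolve_left hx
  · rintro ⟨hx, hy⟩
    by_contra h
    have h1 : x ⋏ (x ⇾ y) ∈ (φ P).carrier := (φ P).inf_mem _ (hP hx) _ h
    rw [IsNelsonAlgebra.inf_imp, inf_mem_iff, sup_mem_iff] at h1
    exact h1.2.elim (fun h2 => h2 (by rwa [IsNelsonAlgebra.neg_neg])) fun h2 => h2 hy

end Nelson

section FiveValued

variable {N : Type u} [NelsonOps N] [IsFiveValuedNelson N] {P Q : PrimeFilter N} {x y z : N}

/-- The weak negation `x ⇾ 0`. -/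
abbrev weakNeg (x : N) : N := x ⇾ ∼NelsonOps.one

open IsNelsonAlgebra

theorem five_valued_mp (hP : P ≤ φ P) (h : (x ⇾ z) ⇾ y ∈ P.carrier)
    (h' : (y ⇾ x) ⇾ y ∈ P.carrier) : y ∈ P.carrier :=
  (isDeductive hP).mp h' ((isDeductive hP).mem_of_imp_eq_one h
    (IsFiveValuedNelson.five_valued x y z))

/-- The weak law of excluded middle: the five-valued axiom with `weakNeg x ⋎ weakNeg (weakNeg x)`
for `y` and `0` for `z`. -/
theorem weakNeg_mem_or (hP : P ≤ φ P) (x : N) :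
    weakNeg x ∈ P.carrier ∨ weakNeg (weakNeg x) ∈ P.carrier := by
  rw [← sup_mem_iff]
  refine five_valued_mp (x := x) (z := ∼NelsonOps.one) hP ?_ ?_
  · exact (isDeductive hP).imp_mem fun E hE _ h => hE.mem_of_le h le_sup_left
  · refine (isDeductive hP).imp_mem fun E hE _ h => ?_
    refine hE.mem_of_le (hE.imp_mem fun E' hE' hEE' hx => ?_) le_sup_right
    exact hE'.mp (hE'.mp (hE'.mem_of_le hx le_sup_left) (hEE' h)) hx

theorem weakNeg_not_mem (hP : P ≤ φ P) (hx : x ∈ P.carrier) : weakNeg x ∉ P.carrier :=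
  fun h => P.zero_notMem ((isDeductive hP).mp hx h)

theorem weakNeg_weakNeg_mem_iff (hP : P ≤ φ P) :
    weakNeg (weakNeg x) ∈ P.carrier ↔ weakNeg x ∉ P.carrier :=
  ⟨fun h h' => weakNeg_not_mem hP h' h, (weakNeg_mem_or hP x).resolve_left⟩

/-- The largest prime filter above `P` that is contained in its image under the involution. It
consists of the elements that are not refuted in `P`. -/
def summit (P : PrimeFilter N) (hP : P ≤ φ P) : PrimeFilter N where
  carrier := {x | weakNeg x ∉ P.carrier}
  one_mem := weakNeg_not_mem hP P.one_mem
  ne_univ hu := by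
    have h : ∼NelsonOps.one ∈ {x : N | weakNeg x ∉ P.carrier} := by rw [hu]; trivial
    exact h (by rw [weakNeg, IsNelsonAlgebra.imp_self]; exact P.one_mem)
  inf_mem x hx y hy h := by
    have hD := isDeductive hP
    change weakNeg x ∉ P.carrier at hx
    change weakNeg y ∉ P.carrier at hy
    rw [← weakNeg_weakNeg_mem_iff hP] at hx hy
    refine P.zero_notMem (hD.mp (hD.imp_mem fun E hE hPE hxE => ?_) hx)
    refine hE.mp (hE.imp_mem fun E' hE' hEE' hyE => ?_) (hPE hy)
    exact hE'.mp (hE'.inf_mem (hEE' hxE) hyE) (hEE' (hPE h))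
  mem_of_le x hx y hxy h := hx <| (isDeductive hP).imp_mem fun E hE hPE hxE =>
    hE.mp (hE.mem_of_le hxE hxy) (hPE h)
  prime x y h := by
    by_contra hc
    simp only [Set.mem_ofPred_eq, not_or, not_not] at hc
    exact h <| (isDeductive hP).imp_mem fun E hE hPE hxy =>
      hE.sup_elim hxy (hPE hc.1) (hPE hc.2)

variable (hP : P ≤ φ P)

theorem le_summit : P ≤ P.summit hP := fun _ hx => weakNeg_not_mem hP hx

theorem summit_le_φ : P.summit hP ≤ φ (P.summit hP) := fun x hx hx' => by
  refine (P.summit hP).inf_mem _ hx _ hx' ?_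
  rw [weakNeg, inf_neg_imp]
  exact P.one_mem

theorem imp_mem_summit_iff : x ⇾ y ∈ (P.summit hP).carrier ↔
    (x ∈ (P.summit hP).carrier → y ∈ (P.summit hP).carrier) := by
  have hD := isDeductive (summit_le_φ hP)
  refine ⟨fun h hx => hD.mp hx h, fun h => ?_⟩
  by_cases hx : x ∈ (P.summit hP).carrier
  · exact hD.mem_of_imp_eq_one (h hx) (imp_imp_left y x)
  · have h1 : weakNeg x ∈ P.carrier := not_not.1 hx
    exact hD.imp_mem fun E hE hPE hxE =>
      hE.mem_of_zero_mem (hE.mp hxE (hPE (le_summit hP h1))) y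

/-- The clause for the implication of the three-element Heyting chain, where `P` and its summit
are the two worlds. -/
theorem imp_mem_iff : x ⇾ y ∈ P.carrier ↔ (x ∈ P.carrier → y ∈ P.carrier) ∧
    (x ∈ (P.summit hP).carrier → y ∈ (P.summit hP).carrier) := by
  have hD := isDeductive hP
  refine ⟨fun h => ⟨fun hx => hD.mp hx h, (imp_mem_summit_iff hP).1 (le_summit hP h)⟩, ?_⟩
  rintro ⟨h1, h2⟩
  by_cases hx : x ∈ (P.summit hP).carrier
  · have hy : weakNeg (weakNeg y) ∈ P.carrier := (weakNeg_weakNeg_mem_iff hP).2 (h2 hx)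
    -- The five-valued axiom puts `x ⋎ (x ⇾ y)` into `P`, because `y` holds at the summit.
    have h3 : x ⋎ (x ⇾ y) ∈ P.carrier := by
      refine five_valued_mp (x := y) (z := ∼NelsonOps.one) hP ?_ ?_
      · exact hD.imp_mem fun E hE hPE h => hE.mem_of_zero_mem (hE.mp h (hPE hy)) _
      · refine hD.imp_mem fun E hE _ h => hE.mem_of_le (hE.imp_mem fun E' hE' hEE' hxE => ?_)
          le_sup_right
        exact hE'.mp (hE'.mem_of_le hxE le_sup_left) (hEE' h)
    rcases P.prime _ _ h3 with h4 | h4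
    · exact hD.mem_of_imp_eq_one (h1 h4) (imp_imp_left y x)
    · exact h4
  · have h3 : weakNeg x ∈ P.carrier := not_not.1 hx
    exact hD.imp_mem fun E hE hPE hxE => hE.mem_of_zero_mem (hE.mp hxE (hPE h3)) y

end FiveValued

end PrimeFilter

/-! ### Homomorphisms into the five-element chain -/

namespace C5

theorem eq_of_thresholds {a b : C5.{u}} (h4 : 4 ≤ a.num ↔ 4 ≤ b.num) (h3 : 3 ≤ a.num ↔ 3 ≤ b.num)
    (h2 : 2 ≤ a.num ↔ 2 ≤ b.num) (h1 : 1 ≤ a.num ↔ 1 ≤ b.num) : a = b := by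
  obtain ⟨a⟩ := a
  obtain ⟨b⟩ := b
  refine ext_num ?_
  revert a b
  decide

theorem four_le_imp (a b : C5.{u}) : 4 ≤ (a ⇾ b).num ↔
    (4 ≤ a.num → 4 ≤ b.num) ∧ (3 ≤ a.num → 3 ≤ b.num) := by
  obtain ⟨a⟩ := a
  obtain ⟨b⟩ := b
  rw [num_imp]; revert a b; decide

theorem three_le_imp (a b : C5.{u}) : 3 ≤ (a ⇾ b).num ↔ (3 ≤ a.num → 3 ≤ b.num) := by
  obtain ⟨a⟩ := a
  obtain ⟨b⟩ := b
  rw [num_imp]; revert a b; decide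

theorem two_le_imp (a b : C5.{u}) : 2 ≤ (a ⇾ b).num ↔ (3 ≤ a.num → 2 ≤ b.num) := by
  obtain ⟨a⟩ := a
  obtain ⟨b⟩ := b
  rw [num_imp]; revert a b; decide

theorem one_le_imp (a b : C5.{u}) : 1 ≤ (a ⇾ b).num ↔ (4 ≤ a.num → 1 ≤ b.num) := by
  obtain ⟨a⟩ := a
  obtain ⟨b⟩ := b
  rw [num_imp]; revert a b; decide

theorem le_num_neg (a : C5.{u}) : (4 ≤ (∼a).num ↔ ¬ 1 ≤ a.num) ∧ (3 ≤ (∼a).num ↔ ¬ 2 ≤ a.num) ∧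
    (2 ≤ (∼a).num ↔ ¬ 3 ≤ a.num) ∧ (1 ≤ (∼a).num ↔ ¬ 4 ≤ a.num) := by
  obtain ⟨a⟩ := a
  rw [num_neg]; revert a; decide

theorem eq_one_iff (a : C5.{u}) : a = NelsonOps.one ↔ 4 ≤ a.num := by
  refine ⟨fun h => h ▸ le_rfl, fun h => ext_num ?_⟩
  rw [num_one]
  exact le_antisymm (Fin.le_last _) h

end C5

namespace PrimeFilter

open InvolutivePoset

theorem mem_ker {N : Type u} [NelsonOps N] {x : N} {h : N → C5.{u}} {hh : IsNelsonHom h} :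
    x ∈ (ker h hh).carrier ↔ 4 ≤ (h x).num :=
  C5.eq_one_iff _

variable {N : Type u} [NelsonOps N] [IsFiveValuedNelson N] {P : PrimeFilter N} {x y : N}

/-- The valuation that counts how many members of the chain
`P ≤ summit P ≤ φ (summit P) ≤ φ P` contain `x`. -/
noncomputable def valuation (P : PrimeFilter N) (hP : P ≤ φ P) (x : N) : C5.{u} :=
  open Classical in
  if x ∈ P.carrier then ⟨4⟩ else if x ∈ (P.summit hP).carrier then ⟨3⟩ else
    if ∼x ∉ (P.summit hP).carrier then ⟨2⟩ else if ∼x ∉ P.carrier then ⟨1⟩ else ⟨0⟩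

theorem le_valuation (hP : P ≤ φ P) (x : N) :
    (4 ≤ (P.valuation hP x).num ↔ x ∈ P.carrier) ∧
    (3 ≤ (P.valuation hP x).num ↔ x ∈ (P.summit hP).carrier) ∧
    (2 ≤ (P.valuation hP x).num ↔ ∼x ∉ (P.summit hP).carrier) ∧
    (1 ≤ (P.valuation hP x).num ↔ ∼x ∉ P.carrier) := by
  have h1 : x ∈ P.carrier → x ∈ (P.summit hP).carrier := fun h => le_summit hP h
  have h2 : x ∈ (P.summit hP).carrier → ∼x ∉ (P.summit hP).carrier := fun h => summit_le_φ hP h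
  have h3 : ∼x ∈ P.carrier → ∼x ∈ (P.summit hP).carrier := fun h => le_summit hP h
  unfold valuation
  split_ifs <;> simp_all

theorem isNelsonHom_valuation (hP : P ≤ φ P) : IsNelsonHom (P.valuation hP) where
  map_one := by
    rw [C5.eq_one_iff, (le_valuation hP _).1]; exact P.one_mem
  map_neg x := by
    apply C5.eq_of_thresholds <;>
      simp only [C5.le_num_neg, le_valuation, IsNelsonAlgebra.neg_neg, not_not]
  map_inf x y := by
    apply C5.eq_of_thresholds <;>
      simp only [C5.num_inf, le_min_iff, le_valuation, inf_mem_iff, IsNelsonAlgebra.neg_inf,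
        sup_mem_iff, not_or]
  map_sup x y := by
    apply C5.eq_of_thresholds <;>
      simp only [C5.num_sup, le_max_iff, le_valuation, inf_mem_iff, IsNelsonAlgebra.neg_sup,
        sup_mem_iff, not_and_or]
  map_imp x y := by
    apply C5.eq_of_thresholds <;>
      simp only [C5.four_le_imp, C5.three_le_imp, C5.two_le_imp, C5.one_le_imp, le_valuation,
        imp_mem_iff hP, imp_mem_summit_iff hP, neg_imp_mem_iff hP,
        neg_imp_mem_iff (summit_le_φ hP), not_and]

/-- Every prime filter below its image is the kernel of a homomorphism into `C₅`. -/
theorem exists_ker_eq (hP : P ≤ φ P) : ∃ (h : N → C5.{u}) (hh : IsNelsonHom h), ker h hh = P :=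
  ⟨_, isNelsonHom_valuation hP, PrimeFilter.ext (Set.ext fun x =>
    (C5.eq_one_iff _).trans (le_valuation hP x).1)⟩

theorem exists_ker_eq_or (Q : PrimeFilter N) : ∃ (h : N → C5.{u}) (hh : IsNelsonHom h),
    Q = ker h hh ∨ Q = φ (ker h hh) := by
  rcases comparable Q with hQ | hQ
  · obtain ⟨h, hh, e⟩ := exists_ker_eq hQ
    exact ⟨h, hh, Or.inl e.symm⟩
  · obtain ⟨h, hh, e⟩ := exists_ker_eq (P := φ Q) (by rwa [φ_φ])
    exact ⟨h, hh, Or.inr (by rw [e, φ_φ])⟩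

theorem mem_φ_ker {h : N → C5.{u}} {hh : IsNelsonHom h} :
    x ∈ (φ (ker h hh)).carrier ↔ 1 ≤ (h x).num := by
  rw [mem_φ, mem_ker, hh.map_neg, (C5.le_num_neg _).1, not_not]

theorem ker_le_φ_ker (h : N → C5.{u}) (hh : IsNelsonHom h) : ker h hh ≤ φ (ker h hh) :=
  fun _ hx => mem_φ_ker.2 (le_trans (by decide) (mem_ker.1 hx))

end PrimeFilter

/-- The homomorphisms into `C₅` separate the points of a five-valued Nelson algebra. -/
theorem IsFiveValuedNelson.exists_hom_ne {N : Type u} [NelsonOps N] [IsFiveValuedNelson N]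
    {x y : N} (hxy : x ≠ y) : ∃ h : N → C5.{u}, IsNelsonHom h ∧ h x ≠ h y := by
  obtain ⟨P, hP⟩ := IsNelsonAlgebra.exists_primeFilter_of_ne hxy
  obtain ⟨h, hh, e⟩ := P.exists_ker_eq_or
  refine ⟨h, hh, fun he => hP ?_⟩
  rcases e with rfl | rfl
  · rw [PrimeFilter.mem_ker, PrimeFilter.mem_ker, he]
  · rw [PrimeFilter.mem_φ_ker, PrimeFilter.mem_φ_ker, he]

/-! ### Free five-valued Nelson algebras -/

theorem IsNelsonHom.eq_of_generates {F : Type u} {N : Type v} [NelsonOps F] [NelsonOps N]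
    {G : Set F} (hG : ∀ S : Set F, IsNelsonSubalgebra S → G ⊆ S → S = Set.univ) {h k : F → N}
    (hh : IsNelsonHom h) (hk : IsNelsonHom k) (e : ∀ g ∈ G, h g = k g) : h = k := by
  have hS := hG {x | h x = k x}
    { one_mem := hh.map_one.trans hk.map_one.symm
      neg_mem := fun x hx => by
        change h _ = k _
        rw [hh.map_neg, hk.map_neg, hx]
      inf_mem := fun x hx y hy => by
        change h _ = k _
        rw [hh.map_inf, hk.map_inf, hx, hy]
      sup_mem := fun x hx y hy => by
        change h _ = k _
        rw [hh.map_sup, hk.map_sup, hx, hy]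
      imp_mem := fun x hx y hy => by
        change h _ = k _
        rw [hh.map_imp, hk.map_imp, hx, hy] } e
  exact funext fun x => (hS.symm ▸ Set.mem_univ x : x ∈ {x | h x = k x})

theorem IsNelsonHom.comp {L M : Type*} {N : Type*} [NelsonOps L] [NelsonOps M] [NelsonOps N]
    {h : M → N} {k : L → M} (hh : IsNelsonHom h) (hk : IsNelsonHom k) :
    IsNelsonHom fun x => h (k x) where
  map_one := by rw [hk.map_one, hh.map_one]
  map_neg x := by rw [hk.map_neg, hh.map_neg]
  map_inf x y := by rw [hk.map_inf, hh.map_inf]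
  map_sup x y := by rw [hk.map_sup, hh.map_sup]
  map_imp x y := by rw [hk.map_imp, hh.map_imp]

/-- Terms in the signature of Nelson algebras with variables in `X`. -/
inductive NelsonTerm (X : Type u) : Type u
  | var (x : X)
  | one
  | neg (s : NelsonTerm X)
  | inf (s t : NelsonTerm X)
  | sup (s t : NelsonTerm X)
  | imp (s t : NelsonTerm X)

namespace NelsonTerm

variable {X : Type u}

/-- The value of a term under an assignment of the variables. -/
def eval {N : Type v} [NelsonOps N] (f : X → N) : NelsonTerm X → N
  | var x => f x
  | one => NelsonOps.one
  | neg s => ∼(eval f s)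
  | inf s t => eval f s ⋏ eval f t
  | sup s t => eval f s ⋎ eval f t
  | imp s t => eval f s ⇾ eval f t

theorem _root_.IsNelsonHom.map_eval {M : Type*} {N : Type*} [NelsonOps M] [NelsonOps N] {h : M → N}
    (hh : IsNelsonHom h) (f : X → M) (t : NelsonTerm X) :
    h (eval f t) = eval (fun x => h (f x)) t := by
  induction t with
  | var x => rfl
  | one => exact hh.map_one
  | neg s hs => simp only [eval, hh.map_neg, hs]
  | inf s t hs ht => simp only [eval, hh.map_inf, hs, ht]
  | sup s t hs ht => simp only [eval, hh.map_sup, hs, ht]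
  | imp s t hs ht => simp only [eval, hh.map_imp, hs, ht]

/-- Two terms are identified when they agree under all assignments in `C₅`. -/
def setoid (X : Type u) : Setoid (NelsonTerm X) where
  r s t := ∀ f : X → C5.{u}, eval f s = eval f t
  iseqv := ⟨fun _ _ => rfl, fun h f => (h f).symm, fun h h' f => (h f).trans (h' f)⟩

/-- An equation that holds in `C₅` holds in every five-valued Nelson algebra. -/
theorem eval_eq_of_forall_C5 {N : Type u} [NelsonOps N] [IsFiveValuedNelson N] (f : X → N)
    {s t : NelsonTerm X} (hst : ∀ f : X → C5.{u}, eval f s = eval f t) : eval f s = eval f t := by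
  by_contra hne
  obtain ⟨h, hh, h1⟩ := IsFiveValuedNelson.exists_hom_ne hne
  exact h1 (by rw [hh.map_eval, hh.map_eval, hst])

end NelsonTerm

open NelsonTerm

/-- The free five-valued Nelson algebra over `X`: terms modulo the equations of `C₅`. -/
def FreeNelson (X : Type u) : Type u := Quotient (NelsonTerm.setoid X)

namespace FreeNelson

variable {X : Type u}

/-- The class of a term. -/
def mk (t : NelsonTerm X) : FreeNelson X := Quotient.mk (NelsonTerm.setoid X) t

instance : NelsonOps (FreeNelson X) where
  one := mk .one
  neg := Quotient.map .neg fun s s' h f => by simp only [eval, h f]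
  inf := Quotient.map₂ .inf fun s s' h t t' h' f => by simp only [eval, h f, h' f]
  sup := Quotient.map₂ .sup fun s s' h t t' h' f => by simp only [eval, h f, h' f]
  imp := Quotient.map₂ .imp fun s s' h t t' h' f => by simp only [eval, h f, h' f]

instance : IsFiveValuedNelson (FreeNelson X) where
  inf_sup_self := by
    rintro ⟨x⟩ ⟨y⟩
    exact Quotient.sound fun f => IsNelsonAlgebra.inf_sup_self (eval f x) (eval f y)
  inf_sup := by
    rintro ⟨x⟩ ⟨y⟩ ⟨z⟩
    exact Quotient.sound fun f => IsNelsonAlgebra.inf_sup (eval f x) (eval f y) (eval f z)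
  neg_neg := by
    rintro ⟨x⟩
    exact Quotient.sound fun f => IsNelsonAlgebra.neg_neg (eval f x)
  neg_sup := by
    rintro ⟨x⟩ ⟨y⟩
    exact Quotient.sound fun f => IsNelsonAlgebra.neg_sup (eval f x) (eval f y)
  kleene := by
    rintro ⟨x⟩ ⟨y⟩
    exact Quotient.sound fun f => IsNelsonAlgebra.kleene (eval f x) (eval f y)
  imp_self := by
    rintro ⟨x⟩
    exact Quotient.sound fun f => IsNelsonAlgebra.imp_self (eval f x)
  imp_imp := by
    rintro ⟨x⟩ ⟨y⟩ ⟨z⟩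
    exact Quotient.sound fun f => IsNelsonAlgebra.imp_imp (eval f x) (eval f y) (eval f z)
  inf_imp := by
    rintro ⟨x⟩ ⟨y⟩
    exact Quotient.sound fun f => IsNelsonAlgebra.inf_imp (eval f x) (eval f y)
  five_valued := by
    rintro ⟨x⟩ ⟨y⟩ ⟨z⟩
    exact Quotient.sound fun f =>
      IsFiveValuedNelson.five_valued (eval f x) (eval f y) (eval f z)

/-- The homomorphism that extends an assignment of the variables. -/
def lift {N : Type u} [NelsonOps N] [IsFiveValuedNelson N] (f : X → N) : FreeNelson X → N :=
  Quotient.lift (eval f) fun _ _ => eval_eq_of_forall_C5 f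

theorem isNelsonHom_lift {N : Type u} [NelsonOps N] [IsFiveValuedNelson N] (f : X → N) :
    IsNelsonHom (lift f) where
  map_one := rfl
  map_neg := by rintro ⟨x⟩; rfl
  map_inf := by rintro ⟨x⟩ ⟨y⟩; rfl
  map_sup := by rintro ⟨x⟩ ⟨y⟩; rfl
  map_imp := by rintro ⟨x⟩ ⟨y⟩; rfl

theorem mk_var_injective : Function.Injective fun x : X => mk (var x) := by
  classical
  intro x y h
  by_contra hne
  have h1 := congrArg (lift fun z => if z = x then C5.one.{u} else C5.zero.{u}) h
  have h2 : (if x = x then C5.one.{u} else C5.zero.{u}) =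
      if y = x then C5.one.{u} else C5.zero.{u} := h1
  rw [if_pos rfl, if_neg fun h => hne h.symm] at h2
  exact absurd (congrArg C5.num h2) (by decide)

theorem isFreeGeneratingSet (X : Type u) :
    IsFreeGeneratingSet (Set.range fun x : X => mk (var x)) := by
  have hgen : ∀ S : Set (FreeNelson X), IsNelsonSubalgebra S →
      (Set.range fun x : X => mk (var x)) ⊆ S → S = Set.univ := by
    intro S hS hX
    refine Set.eq_univ_of_forall ?_
    rintro ⟨t⟩
    induction t with
    | var x => exact hX ⟨x, rfl⟩
    | one => exact hS.one_mem
    | neg s hs => exact hS.neg_mem _ hs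
    | inf s t hs ht => exact hS.inf_mem _ hs _ ht
    | sup s t hs ht => exact hS.sup_mem _ hs _ ht
    | imp s t hs ht => exact hS.imp_mem _ hs _ ht
  refine ⟨hgen, fun N _ _ f => ⟨lift fun x => f ⟨_, x, rfl⟩, ⟨isNelsonHom_lift _, ?_⟩, ?_⟩⟩
  · rintro ⟨_, x, rfl⟩
    rfl
  · rintro k ⟨hk, hkf⟩
    refine IsNelsonHom.eq_of_generates hgen hk (isNelsonHom_lift _) ?_
    rintro _ ⟨x, rfl⟩
    exact hkf ⟨_, x, rfl⟩

end FreeNelson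

theorem exists_isFreeGeneratingSet (n : ℕ) :
    ∃ (F : Type u) (_ : NelsonOps F) (_ : IsFiveValuedNelson F) (G : Set F),
      IsFreeGeneratingSet G ∧ Cardinal.mk G = n :=
  ⟨FreeNelson (ULift (Fin n)), inferInstance, inferInstance, _,
    FreeNelson.isFreeGeneratingSet _, by
      rw [Cardinal.mk_range_eq _ FreeNelson.mk_var_injective]; simp⟩

/-! ### The representation by upward closed sets -/

namespace PrimeFilter

open InvolutivePoset

section

variable {N : Type u} [NelsonOps N] [IsFiveValuedNelson N] {x y : N}

/-- The prime filters satisfy the clause that defines the implication of upward closed sets. A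
witness above `Q ≤ φ Q` is `Q` itself or its summit. -/
theorem imp_not_mem_iff {Q : PrimeFilter N} : x ⇾ y ∉ Q.carrier ↔
    ∃ R, Q ≤ R ∧ x ∈ R.carrier ∧ x ∈ (φ R).carrier ∧ y ∉ R.carrier := by
  constructor
  · intro h
    rcases comparable Q with hQ | hQ
    · rw [imp_mem_iff hQ, not_and_or] at h
      simp only [Classical.not_imp] at h
      rcases h with h | h
      · exact ⟨Q, le_rfl, h.1, hQ h.1, h.2⟩
      · exact ⟨Q.summit hQ, le_summit hQ, h.1, summit_le_φ hQ h.1, h.2⟩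
    · have hQ' : φ Q ≤ φ (φ Q) := by rwa [φ_φ]
      rw [← neg_mem_φ, neg_imp_mem_iff hQ', neg_mem_φ] at h
      exact ⟨Q, le_rfl, hQ h.1, h.1, h.2⟩
  · rintro ⟨R, hQR, h1, h2, h3⟩ h
    exact h3 (mem_of_imp_mem h1 h2 (hQR h))

/-- The elements of the algebra, seen as upward closed sets of prime filters in a connected
component. -/
def stone (P : PrimeFilter N) (x : N) : UpSets (Component P) :=
  ⟨{Q | x ∈ Q.1.carrier}, fun _ _ h hx => h hx⟩

theorem mem_image_φ {X : Type u} [InvolutivePoset X] {U : Set X} {y : X} :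
    y ∈ φ '' U ↔ φ y ∈ U :=
  ⟨by rintro ⟨z, hz, rfl⟩; rwa [φ_φ], fun h => ⟨φ y, h, φ_φ y⟩⟩

theorem isNelsonHom_stone (P : PrimeFilter N) : IsNelsonHom (stone P) where
  map_one := Subtype.ext (Set.eq_univ_of_forall fun Q => Q.1.one_mem)
  map_neg x := Subtype.ext <| Set.ext fun Q => by
    change ∼x ∈ Q.1.carrier ↔ ¬ Q ∈ φ '' (stone P x).1
    rw [mem_image_φ]
    exact not_not.symm
  map_inf x y := Subtype.ext <| Set.ext fun Q => inf_mem_iff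
  map_sup x y := Subtype.ext <| Set.ext fun Q => sup_mem_iff
  map_imp x y := Subtype.ext <| Set.ext fun Q => by
    change x ⇾ y ∈ Q.1.carrier ↔
      ¬ Q ∈ lowerClosure ((stone P x).1 ∩ φ '' (stone P x).1 ∩ (stone P y).1ᶜ)
    rw [← not_iff_not, not_not, imp_not_mem_iff, mem_lowerClosure]
    constructor
    · rintro ⟨R, hQR, h1, h2, h3⟩
      exact ⟨⟨R, .trans _ _ _ Q.2 (.rel _ _ hQR)⟩, ⟨⟨h1, mem_image_φ.2 h2⟩, h3⟩, hQR⟩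
    · rintro ⟨R, ⟨⟨h1, h2⟩, h3⟩, hQR⟩
      exact ⟨R.1, hQR, h1, mem_image_φ.1 h2, h3⟩

end

section Finite

variable {N : Type u} [NelsonOps N] [IsNelsonAlgebra N]

/-- When there are finitely many prime filters, every upward closed set of them comes from an
element. -/
theorem exists_mem_iff_of_isUpperSet [Finite (PrimeFilter N)] {V : Set (PrimeFilter N)}
    (hV : IsUpperSet V) : ∃ x : N, ∀ Q : PrimeFilter N, x ∈ Q.carrier ↔ Q ∈ V := by
  -- First separate one point of `V` from all points outside `V`.
  have step : ∀ Q ∈ V, ∃ x ∈ Q.carrier, ∀ R ∈ Vᶜ, x ∉ R.carrier := by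
    intro Q hQ
    have : ∀ S : Set (PrimeFilter N), S ⊆ Vᶜ → ∃ x ∈ Q.carrier, ∀ R ∈ S, x ∉ R.carrier := by
      intro S hS
      induction S, S.toFinite using Set.Finite.induction_on with
      | empty => exact ⟨_, Q.one_mem, fun R hR => hR.elim⟩
      | @insert R S _ _ ih =>
        obtain ⟨x, hx, hxS⟩ := ih fun R hR => hS (Or.inr hR)
        obtain ⟨z, hz, hzR⟩ := Set.not_subset.1 fun h : Q.carrier ⊆ R.carrier =>
          hS (Or.inl rfl) (hV (show Q ≤ R from h) hQ)
        refine ⟨x ⋏ z, Q.inf_mem _ hx _ hz, ?_⟩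
        rintro R' (rfl | hR') h
        · exact hzR (inf_mem_iff.1 h).2
        · exact hxS R' hR' (inf_mem_iff.1 h).1
    exact this _ le_rfl
  have : ∀ S : Set (PrimeFilter N), S ⊆ V →
      ∃ x, (∀ Q ∈ S, x ∈ Q.carrier) ∧ ∀ R ∈ Vᶜ, x ∉ R.carrier := by
    intro S hS
    induction S, S.toFinite using Set.Finite.induction_on with
    | empty => exact ⟨∼NelsonOps.one, fun Q hQ => hQ.elim, fun R _ => R.zero_notMem⟩
    | @insert Q S _ _ ih =>
      obtain ⟨x, hxS, hx⟩ := ih fun R hR => hS (Or.inr hR)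
      obtain ⟨z, hzQ, hz⟩ := step Q (hS (Or.inl rfl))
      refine ⟨x ⋎ z, ?_, fun R hR h => (R.prime _ _ h).elim (hx R hR) (hz R hR)⟩
      rintro Q' (rfl | hQ')
      · exact sup_mem_iff.2 (Or.inr hzQ)
      · exact sup_mem_iff.2 (Or.inl (hxS Q' hQ'))
  obtain ⟨x, h1, h2⟩ := this V le_rfl
  exact ⟨x, fun Q => ⟨fun h => by_contra fun hQ => h2 Q hQ h, h1 Q⟩⟩

end Finite

end PrimeFilter

/-- The equations of five-valued Nelson algebras pass to homomorphic images. -/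
theorem IsFiveValuedNelson.of_surjective {M : Type u} {N : Type v} [NelsonOps M] [NelsonOps N]
    [IsFiveValuedNelson M] {h : M → N} (hh : IsNelsonHom h) (hs : Function.Surjective h) :
    IsFiveValuedNelson N where
  inf_sup_self := hs.forall₂.2 fun x y => by
    rw [← hh.map_sup, ← hh.map_inf, IsNelsonAlgebra.inf_sup_self]
  inf_sup := hs.forall₃.2 fun x y z => by
    rw [← hh.map_sup, ← hh.map_inf, IsNelsonAlgebra.inf_sup, hh.map_sup, hh.map_inf, hh.map_inf]
  neg_neg := hs.forall.2 fun x => by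
    rw [← hh.map_neg, ← hh.map_neg, IsNelsonAlgebra.neg_neg]
  neg_sup := hs.forall₂.2 fun x y => by
    rw [← hh.map_sup, ← hh.map_neg, IsNelsonAlgebra.neg_sup, hh.map_inf, hh.map_neg, hh.map_neg]
  kleene := hs.forall₂.2 fun x y => by
    rw [← hh.map_neg, ← hh.map_neg, ← hh.map_inf, ← hh.map_sup, ← hh.map_inf,
      ← IsNelsonAlgebra.kleene]
  imp_self := hs.forall.2 fun x => by
    rw [← hh.map_imp, IsNelsonAlgebra.imp_self, hh.map_one]
  imp_imp := hs.forall₃.2 fun x y z => by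
    rw [← hh.map_imp, ← hh.map_imp, IsNelsonAlgebra.imp_imp, hh.map_imp, hh.map_inf]
  inf_imp := hs.forall₂.2 fun x y => by
    rw [← hh.map_imp, ← hh.map_inf, IsNelsonAlgebra.inf_imp, hh.map_inf, hh.map_sup, hh.map_neg]
  five_valued := hs.forall₃.2 fun x y z => by
    simp only [← hh.map_imp, ← hh.map_one, IsFiveValuedNelson.five_valued x y z]

/-! ### Counting upward closed sets -/

section Counting

open InvolutivePoset

variable {X : Type u} [InvolutivePoset X] {p : X}

theorem InvolutivePoset.φ_le_comm {x y : X} : φ x ≤ y ↔ φ y ≤ x :=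
  ⟨fun h => by simpa only [φ_φ] using φ_anti _ _ h, fun h => by simpa only [φ_φ] using φ_anti _ _ h⟩

/-- Suppose that every point is at most `p` or at least `φ p`, and that the points strictly below
`p` are minimal. An upward closed set without `φ p` is the image of a set of points strictly below
`p`. One that contains `p` is determined by its points strictly below `p`. The only other one is
the set of the points above `φ p`, which contains `p` if `φ p = p`. -/
theorem UpSets.bijective_of_antichain (hp : p ≤ φ p) (hc : ∀ y, y ≤ p ∨ φ p ≤ y)
    (ha : ∀ y z, y ≤ z → z < p → y = z) :
    ∃ e : Set (Set.Iio p) ⊕ Set (Set.Iio p) ⊕ {_u : Unit // φ p ≠ p} → UpSets X,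
      Function.Bijective e := by
  have hl : ∀ l : Set.Iio p, ¬ φ l.1 ≤ φ p := fun l h => by
    have := φ_anti _ _ h
    rw [φ_φ, φ_φ] at this
    exact absurd l.2 (not_lt_of_ge this)
  let a : Set (Set.Iio p) → UpSets X := fun S => ⟨{y | ∃ l ∈ S, y = φ l.1}, by
    rintro _ z hyz ⟨l, hlS, rfl⟩
    rcases hc z with h | h
    · exact absurd (hyz.trans (h.trans hp)) (hl l)
    · exact ⟨l, hlS, by rw [← ha _ _ (φ_le_comm.1 hyz) l.2, φ_φ]⟩⟩
  let b : Set (Set.Iio p) → UpSets X := fun S =>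
    ⟨{y | φ p ≤ y ∨ y = p ∨ ∃ l ∈ S, y = l.1}, by
      rintro y z hyz (h | rfl | ⟨l, hlS, rfl⟩)
      · exact Or.inl (h.trans hyz)
      · exact (hc z).elim (fun h => Or.inr (Or.inl (le_antisymm h hyz))) Or.inl
      · rcases hc z with h | h
        · rcases h.eq_or_lt with h | h
          · exact Or.inr (Or.inl h)
          · exact Or.inr (Or.inr ⟨l, hlS, (ha _ _ hyz h).symm⟩)
        · exact Or.inl h⟩
  let c : UpSets X := ⟨Set.Ici (φ p), isUpperSet_Ici _⟩
  have ha1 : ∀ S (l : Set.Iio p), φ l.1 ∈ (a S).1 ↔ l ∈ S := fun S l =>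
    ⟨fun ⟨l', h, e⟩ => by
      have h2 : l = l' := Subtype.ext (by rw [← φ_φ l.1, e, φ_φ])
      rwa [h2], fun h => ⟨l, h, rfl⟩⟩
  have hb1 : ∀ S (l : Set.Iio p), l.1 ∈ (b S).1 ↔ l ∈ S := fun S l => by
    refine ⟨?_, fun h => Or.inr (Or.inr ⟨l, h, rfl⟩)⟩
    rintro (h | h | ⟨l', h, e⟩)
    · exact absurd l.2 (not_lt_of_ge (hp.trans h))
    · exact absurd h (ne_of_lt l.2)
    · rwa [Subtype.ext e]
  have ha2 : ∀ S, φ p ∉ (a S).1 := fun S ⟨l, _, e⟩ => hl l e.ge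
  have ha3 : ∀ S, p ∉ (a S).1 := fun S h => ha2 S ((a S).2 hp h)
  have hb2 : ∀ S, p ∈ (b S).1 := fun S => Or.inr (Or.inl rfl)
  have hc2 : φ p ∈ c.1 := le_rfl
  have hc3 : φ p ≠ p → p ∉ c.1 := fun h h' => h (le_antisymm h' hp)
  refine ⟨Sum.elim a (Sum.elim b fun _ => c), ?_, ?_⟩
  · rintro (S | S | ⟨⟨⟩, h⟩) (S' | S' | ⟨⟨⟩, h'⟩) e
    · have e : a S = a S' := e
      congr 1
      ext l
      rw [← ha1, e, ha1]
    · have e : a S = b S' := e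
      exact absurd (e ▸ hb2 S') (ha3 S)
    · have e : a S = c := e
      exact absurd (e ▸ hc2) (ha2 S)
    · have e : b S = a S' := e
      exact absurd (e ▸ hb2 S) (ha3 S')
    · have e : b S = b S' := e
      congr 2
      ext l
      rw [← hb1, e, hb1]
    · have e : b S = c := e
      exact absurd (e ▸ hb2 S) (hc3 h')
    · have e : c = a S' := e
      exact absurd (e ▸ hc2) (ha2 S')
    · have e : c = b S' := e
      exact absurd (e ▸ hb2 S') (hc3 h)
    · rfl
  · intro U
    by_cases h1 : p ∈ U.1
    · refine ⟨Sum.inr (Sum.inl {l | l.1 ∈ U.1}), Subtype.ext (Set.ext fun y => ⟨?_, fun hy => ?_⟩)⟩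
      · rintro (h | rfl | ⟨l, h, rfl⟩)
        · exact U.2 (hp.trans h) h1
        · exact h1
        · exact h
      · rcases hc y with h | h
        · rcases h.eq_or_lt with h | h
          · exact Or.inr (Or.inl h)
          · exact Or.inr (Or.inr ⟨⟨y, h⟩, hy, rfl⟩)
        · exact Or.inl h
    · by_cases h2 : φ p ∈ U.1
      · refine ⟨Sum.inr (Sum.inr ⟨(), fun h => h1 (h ▸ h2)⟩),
          Subtype.ext (Set.ext fun y => ⟨fun h => U.2 h h2, fun hy => ?_⟩)⟩
        exact (hc y).resolve_left fun h => h1 (U.2 h hy)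
      · refine ⟨Sum.inl {l | φ l.1 ∈ U.1},
          Subtype.ext (Set.ext fun y => ⟨?_, fun hy => ?_⟩)⟩
        · rintro ⟨l, h, rfl⟩
          exact h
        · have h3 := (hc y).resolve_left fun h => h1 (U.2 h hy)
          refine ⟨⟨φ y, lt_of_le_of_ne (φ_le_comm.1 h3) fun h => h2 ?_⟩, ?_, (φ_φ y).symm⟩
          · rwa [← h, φ_φ]
          · change φ (φ y) ∈ U.1
            rwa [φ_φ]

theorem UpSets.card_of_antichain [Finite X] (hp : p ≤ φ p) (hc : ∀ y, y ≤ p ∨ φ p ≤ y)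
    (ha : ∀ y z, y ≤ z → z < p → y = z) :
    Nat.card (UpSets X) = 2 ^ Nat.card (Set.Iic p) + Nat.card {_u : Unit // φ p ≠ p} := by
  classical
  obtain ⟨e, he⟩ := UpSets.bijective_of_antichain hp hc ha
  have h1 : Nat.card (Set.Iic p) = Nat.card (Set.Iio p) + 1 := by
    rw [← Set.Iio_insert, Nat.card_coe_set_eq, Nat.card_coe_set_eq,
      Set.ncard_insert_of_notMem (by simp)]
  have h2 : Nat.card (Set (Set.Iio p)) = 2 ^ Nat.card (Set.Iio p) := by
    have := Fintype.ofFinite (Set.Iio p)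
    rw [Nat.card_eq_fintype_card, Nat.card_eq_fintype_card, Fintype.card_set]
  rw [← Nat.card_eq_of_bijective e he, Nat.card_sum, Nat.card_sum, h1, h2, pow_succ]
  ring

end Counting

/-! ### The prime filters of a free algebra -/

namespace C5

/-- The retraction of `C₅` onto the subalgebra `{0, 1/2, 1}`. -/
def retract (a : C5.{u}) : C5.{u} := ⟨![0, 0, 2, 4, 4] a.num⟩

theorem isNelsonHom_retract : IsNelsonHom retract.{u} where
  map_one := rfl
  map_neg := fun ⟨a⟩ => ext_num (by
    simp only [retract, num_neg]; revert a; decide)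
  map_inf := fun ⟨a⟩ ⟨b⟩ => ext_num (by
    simp only [retract, num_inf]; revert a b; decide)
  map_sup := fun ⟨a⟩ ⟨b⟩ => ext_num (by
    simp only [retract, num_sup]; revert a b; decide)
  map_imp := fun ⟨a⟩ ⟨b⟩ => ext_num (by
    simp only [retract, num_imp]; revert a b; decide)

theorem retract_cases (a : C5.{u}) :
    retract a = zero ∨ retract a = half ∨ retract a = one := by
  obtain ⟨a⟩ := a
  have : ∀ a : Fin 5, ![(0 : Fin 5), 0, 2, 4, 4] a = 0 ∨ ![(0 : Fin 5), 0, 2, 4, 4] a = 2 ∨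
    ![(0 : Fin 5), 0, 2, 4, 4] a = 4 := by decide
  exact (this a).imp (fun h => ext_num h) fun h => h.imp (fun h => ext_num h) fun h => ext_num h

theorem retract_eq_self {a : C5.{u}} (h1 : a.num ≠ 1) (h3 : a.num ≠ 3) : retract a = a := by
  obtain ⟨a⟩ := a
  refine ext_num ?_
  change ![0, 0, 2, 4, 4] a = a
  revert a; decide

theorem retract_eq_self_of_cases {a : C5.{u}} (h : a = zero ∨ a = half ∨ a = one) :
    retract a = a := by
  rcases h with rfl | rfl | rfl <;> rfl

theorem retract_eq_retract_iff {a b : C5.{u}} : retract a = retract b ↔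
    (3 ≤ a.num ↔ 3 ≤ b.num) ∧ (3 ≤ (∼a).num ↔ 3 ≤ (∼b).num) := by
  obtain ⟨a⟩ := a
  obtain ⟨b⟩ := b
  have h : retract ⟨a⟩ = retract (⟨b⟩ : C5.{u}) ↔
      ![(0 : Fin 5), 0, 2, 4, 4] a = ![0, 0, 2, 4, 4] b :=
    ⟨fun h => congrArg num h, fun h => ext_num h⟩
  rw [h, num_neg, num_neg]
  clear h
  revert a b; decide

theorem four_le_retract (a : C5.{u}) : 4 ≤ (retract a).num ↔ 3 ≤ a.num := by
  obtain ⟨a⟩ := a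
  change 4 ≤ ![(0 : Fin 5), 0, 2, 4, 4] a ↔ _
  revert a; decide

open PrimeFilter in
theorem le_weakNeg_weakNeg (a : C5.{u}) :
    (4 ≤ (weakNeg (weakNeg a)).num ↔ 3 ≤ a.num) ∧
    (1 ≤ (weakNeg (weakNeg a)).num ↔ 3 ≤ a.num) := by
  obtain ⟨a⟩ := a
  simp only [weakNeg, num_imp, num_neg, num_one]
  revert a; decide

end C5

theorem IsNelsonHom.map_weakNeg {M N : Type u} [NelsonOps M] [NelsonOps N]
    {h : M → N} (hh : IsNelsonHom h) (x : M) :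
    h (PrimeFilter.weakNeg x) = PrimeFilter.weakNeg (h x) := by
  rw [PrimeFilter.weakNeg, hh.map_imp, hh.map_neg, hh.map_one]

namespace PrimeFilter

open InvolutivePoset

theorem weakNeg_weakNeg_mem_ker {N : Type u} [NelsonOps N] {x : N} {h : N → C5.{u}}
    {hh : IsNelsonHom h} :
    weakNeg (weakNeg x) ∈ (ker h hh).carrier ↔ 3 ≤ (h x).num := by
  rw [mem_ker, hh.map_weakNeg, hh.map_weakNeg, (C5.le_weakNeg_weakNeg _).1]

variable {N : Type u} [NelsonOps N] [IsFiveValuedNelson N] {x : N}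

theorem weakNeg_weakNeg_mem_φ_ker {h : N → C5.{u}} {hh : IsNelsonHom h} :
    weakNeg (weakNeg x) ∈ (φ (ker h hh)).carrier ↔ 3 ≤ (h x).num := by
  rw [mem_φ_ker, hh.map_weakNeg, hh.map_weakNeg, (C5.le_weakNeg_weakNeg _).2]

/-- The element `weakNeg (weakNeg x)` is complemented, so it belongs to all points of a connected
component or to none. -/
theorem weakNeg_weakNeg_mem_iff_of_eqvGen {P Q : PrimeFilter N} (h : Relation.EqvGen (· ≤ ·) P Q) :
    weakNeg (weakNeg x) ∈ P.carrier ↔ weakNeg (weakNeg x) ∈ Q.carrier := by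
  have key : ∀ R : PrimeFilter N,
      weakNeg (weakNeg x) ∈ R.carrier ↔ weakNeg (weakNeg x) ∈ (φ R).carrier := by
    intro R
    obtain ⟨h, hh, e⟩ := R.exists_ker_eq_or
    rcases e with rfl | rfl
    · rw [weakNeg_weakNeg_mem_ker, weakNeg_weakNeg_mem_φ_ker]
    · rw [φ_φ, weakNeg_weakNeg_mem_ker, weakNeg_weakNeg_mem_φ_ker]
  induction h with
  | rel P Q h => exact ⟨fun h1 => h h1, fun h1 => (key P).2 (φ_anti _ _ h ((key Q).1 h1))⟩
  | refl P => rfl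
  | symm P Q _ ih => exact ih.symm
  | trans P Q R _ _ ih ih' => exact ih.trans ih'

/-- If the kernel of `h` is strictly contained in that of `k`, then `k` takes only the values
`0`, `1/2` and `1`. -/
theorem retract_comp_eq_of_ker_lt {h k : N → C5.{u}} {hh : IsNelsonHom h} {hk : IsNelsonHom k}
    (hlt : ker h hh < ker k hk) (y : N) : C5.retract (k y) = k y := by
  have h3 : ∀ z, 3 ≤ (h z).num ↔ 3 ≤ (k z).num := fun z => by
    rw [← weakNeg_weakNeg_mem_ker (hh := hh), ← weakNeg_weakNeg_mem_ker (hh := hk)]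
    exact weakNeg_weakNeg_mem_iff_of_eqvGen (.rel _ _ hlt.le)
  obtain ⟨x, hxk, hxh⟩ := Set.not_subset.1 (show ¬ (ker k hk).carrier ⊆ (ker h hh).carrier from
    not_le_of_gt hlt)
  rw [mem_ker] at hxk hxh
  -- With `h x = 3/4`, `k x = 1` and `k z = 3/4`, the element `x ⇾ z` would lie in the kernel of
  -- `h` only.
  have hne : ∀ z, (k z).num ≠ 3 := fun z hz => by
    have h1 : x ⇾ z ∈ (ker h hh).carrier := by
      rw [mem_ker, hh.map_imp, C5.four_le_imp]
      exact ⟨fun h => absurd h hxh, fun _ => (h3 z).2 hz.ge⟩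
    have h2 := hlt.le h1
    rw [mem_ker, hk.map_imp, C5.four_le_imp, hz] at h2
    exact absurd (h2.1 hxk) (by decide)
  refine C5.retract_eq_self (fun h => hne (∼y) ?_) (hne y)
  rw [hk.map_neg, C5.num_neg, h]
  decide

end PrimeFilter

namespace IsFreeGeneratingSet

open InvolutivePoset PrimeFilter

variable {F : Type u} [NelsonOps F] [IsFiveValuedNelson F] {G : Set F}
  (hG : IsFreeGeneratingSet G)

theorem extend_apply (f : G → C5.{u}) (g : G) : hG.extend f g = f g :=
  (hG.lift C5.{u} f).choose_spec.1.2 g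

theorem eq_extend {h : F → C5.{u}} (hh : IsNelsonHom h) : h = hG.extend fun g => h g :=
  (hG.lift C5.{u} fun g => h g).choose_spec.2 h ⟨hh, fun _ => rfl⟩

theorem ker_eq_kerFilter {h : F → C5.{u}} (hh : IsNelsonHom h) :
    ker h hh = hG.kerFilter fun g => h g := by
  unfold kerFilter
  congr 1
  exact hG.eq_extend hh

theorem exists_kerFilter_eq (Q : PrimeFilter F) :
    ∃ f : G → C5.{u}, Q = hG.kerFilter f ∨ Q = φ (hG.kerFilter f) := by
  obtain ⟨h, hh, e⟩ := Q.exists_ker_eq_or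
  exact ⟨fun g => h g, by rwa [hG.ker_eq_kerFilter hh] at e⟩

theorem mem_kerFilter {f : G → C5.{u}} {x : F} :
    x ∈ (hG.kerFilter f).carrier ↔ 4 ≤ (hG.extend f x).num := mem_ker

theorem mem_φ_kerFilter {f : G → C5.{u}} {x : F} :
    x ∈ (φ (hG.kerFilter f)).carrier ↔ 1 ≤ (hG.extend f x).num := mem_φ_ker

theorem kerFilter_le_φ (f : G → C5.{u}) : hG.kerFilter f ≤ φ (hG.kerFilter f) :=
  ker_le_φ_ker _ _

theorem extend_retract (f : G → C5.{u}) :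
    hG.extend (fun g => C5.retract (f g)) = fun x => C5.retract (hG.extend f x) := by
  rw [hG.eq_extend (C5.isNelsonHom_retract.comp (hG.isNelsonHom_extend f))]
  simp only [extend_apply]

theorem kerFilter_le_kerFilter_retract (f : G → C5.{u}) :
    hG.kerFilter f ≤ hG.kerFilter fun g => C5.retract (f g) := fun x hx => by
  rw [mem_kerFilter, extend_retract, C5.four_le_retract]
  exact le_trans (by decide) (hG.mem_kerFilter.1 hx)

/-- A homomorphism into `C₅` is determined by its kernel `P`: the thresholds `1`, `3/4`, `1/2`
and `1/4` are read off from `P` with the help of `∼` and of the weak negation. -/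
theorem kerFilter_injective : Function.Injective hG.kerFilter := by
  intro f f' e
  have h1 : ∀ x : F, (4 ≤ (hG.extend f x).num ↔ 4 ≤ (hG.extend f' x).num) ∧
      (3 ≤ (hG.extend f x).num ↔ 3 ≤ (hG.extend f' x).num) := fun x => by
    rw [← mem_kerFilter, ← mem_kerFilter, e,
      ← weakNeg_weakNeg_mem_ker (hh := hG.isNelsonHom_extend f),
      ← weakNeg_weakNeg_mem_ker (hh := hG.isNelsonHom_extend f')]
    unfold kerFilter at e
    rw [e]
    exact ⟨Iff.rfl, Iff.rfl⟩
  funext g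
  have h2 := h1 (∼g.1)
  simp only [(hG.isNelsonHom_extend _).map_neg, C5.le_num_neg, not_iff_not] at h2
  rw [← hG.extend_apply f, ← hG.extend_apply f']
  exact C5.eq_of_thresholds (h1 g).1 (h1 g).2 h2.2 h2.1

theorem retract_eq_of_eqvGen {f f' : G → C5.{u}}
    (h : Relation.EqvGen (· ≤ ·) (hG.kerFilter f) (hG.kerFilter f')) (g : G) :
    C5.retract (f g) = C5.retract (f' g) := by
  have h1 : ∀ x : F, 3 ≤ (hG.extend f x).num ↔ 3 ≤ (hG.extend f' x).num := fun x => by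
    rw [← weakNeg_weakNeg_mem_ker (hh := hG.isNelsonHom_extend f),
      ← weakNeg_weakNeg_mem_ker (hh := hG.isNelsonHom_extend f')]
    exact weakNeg_weakNeg_mem_iff_of_eqvGen h
  rw [C5.retract_eq_retract_iff, ← hG.extend_apply f, ← hG.extend_apply f',
    ← (hG.isNelsonHom_extend f).map_neg, ← (hG.isNelsonHom_extend f').map_neg]
  exact ⟨h1 _, h1 _⟩

theorem eqvGen_kerFilter_retract_iff {f : ThreeValuedFun G} {f' : G → C5.{u}} :
    Relation.EqvGen (· ≤ ·) (hG.kerFilter f.1) (hG.kerFilter f') ↔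
      (fun g => C5.retract (f' g)) = f.1 := by
  constructor
  · intro h
    funext g
    rw [← hG.retract_eq_of_eqvGen h, C5.retract_eq_self_of_cases (f.2 g)]
  · intro h
    rw [← h]
    exact .symm _ _ (.rel _ _ (hG.kerFilter_le_kerFilter_retract f'))

/-- The connected components of the space of prime filters are indexed by the three-valued
functions on the generators. -/
theorem existsUnique_eqvGen (Q : PrimeFilter F) : ∃! f : ThreeValuedFun G,
    Relation.EqvGen (· ≤ ·) (hG.kerFilter f.1) Q := by
  obtain ⟨f', e⟩ := hG.exists_kerFilter_eq Q
  have h1 : Relation.EqvGen (· ≤ ·) (hG.kerFilter f') Q := by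
    rcases e with rfl | rfl
    · exact .refl _
    · exact .rel _ _ (hG.kerFilter_le_φ f')
  refine ⟨⟨fun g => C5.retract (f' g), fun g => C5.retract_cases _⟩,
    .trans _ _ _ (hG.eqvGen_kerFilter_retract_iff.2 rfl) h1, fun f hf => Subtype.ext ?_⟩
  exact (hG.eqvGen_kerFilter_retract_iff.1 (.trans _ _ _ hf (.symm _ _ h1))).symm

theorem finite_primeFilter (hG : IsFreeGeneratingSet G) [Finite G] : Finite (PrimeFilter F) := by
  have : Finite C5.{u} := Finite.of_injective C5.num fun _ _ => C5.ext_num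
  refine Finite.of_surjective
    (Sum.elim hG.kerFilter fun f => φ (hG.kerFilter f)) fun Q => ?_
  obtain ⟨f, rfl | rfl⟩ := hG.exists_kerFilter_eq Q
  exacts [⟨Sum.inl f, rfl⟩, ⟨Sum.inr f, rfl⟩]

/-! ### The product decomposition -/

/-- The family of the maps from a free algebra to its factors. -/
noncomputable def toFactors (x : F) (f : ThreeValuedFun G) : hG.Factor f :=
  stone (hG.kerFilter f.1) x

theorem isNelsonHom_toFactors : IsNelsonHom hG.toFactors where
  map_one := funext fun _ => (isNelsonHom_stone _).map_one
  map_neg x := funext fun _ => (isNelsonHom_stone _).map_neg x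
  map_inf x y := funext fun _ => (isNelsonHom_stone _).map_inf x y
  map_sup x y := funext fun _ => (isNelsonHom_stone _).map_sup x y
  map_imp x y := funext fun _ => (isNelsonHom_stone _).map_imp x y

theorem bijective_toFactors [Finite G] : Function.Bijective hG.toFactors := by
  constructor
  · intro x y hxy
    by_contra hne
    obtain ⟨P, hP⟩ := IsNelsonAlgebra.exists_primeFilter_of_ne hne
    obtain ⟨f, hf, -⟩ := hG.existsUnique_eqvGen P
    have h1 := congrArg Subtype.val (congrFun hxy f)
    exact hP (Set.ext_iff.1 h1 ⟨P, hf⟩)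
  · intro U
    have := hG.finite_primeFilter
    -- The components are disjoint and closed upwards, so the sets `U f` glue to an upward
    -- closed set.
    obtain ⟨x, hx⟩ := exists_mem_iff_of_isUpperSet
      (V := {Q : PrimeFilter F | ∃ (f : ThreeValuedFun G)
        (h : Relation.EqvGen (· ≤ ·) (hG.kerFilter f.1) Q), (⟨Q, h⟩ : Component _) ∈ (U f).1}) (by
        rintro Q R hQR ⟨f, h, hU⟩
        exact ⟨f, .trans _ _ _ h (.rel _ _ hQR), (U f).2 (a := ⟨Q, h⟩) hQR hU⟩)
    refine ⟨x, funext fun f => Subtype.ext (Set.ext fun Q => (hx Q.1).trans ⟨?_, fun h => ?_⟩)⟩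
    · rintro ⟨f', h, hU⟩
      obtain rfl := (hG.existsUnique_eqvGen Q.1).unique h Q.2
      exact hU
    · exact ⟨f, Q.2, h⟩

theorem isFiveValuedNelson_factor [Finite G] (f : ThreeValuedFun G) :
    IsFiveValuedNelson (hG.Factor f) := by
  classical
  refine IsFiveValuedNelson.of_surjective (isNelsonHom_stone (hG.kerFilter f.1)) fun U => ?_
  obtain ⟨x, hx⟩ := hG.bijective_toFactors.2
    (Function.update (fun f => stone (hG.kerFilter f.1) NelsonOps.one) f U)
  have := congrFun hx f
  rw [Function.update_self] at this
  exact ⟨x, this⟩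

end IsFreeGeneratingSet

/-! ### Cardinalities -/

/-- The number of functions with one choice for each value on `S` and two choices elsewhere. -/
theorem Nat.card_pi_subtype_one_two {G : Type u} {C : Type v} [Finite G] {p : G → C → Prop}
    (S : Set G) (h1 : ∀ g ∈ S, Nat.card {c // p g c} = 1)
    (h2 : ∀ g, g ∉ S → Nat.card {c // p g c} = 2) :
    Nat.card {h : G → C // ∀ g, p g (h g)} = 2 ^ (Nat.card G - Nat.card S) := by
  classical
  have := Fintype.ofFinite G
  have h3 : ∀ g, Nat.card {c // p g c} = if g ∈ S then 1 else 2 := fun g => by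
    split_ifs with h
    exacts [h1 g h, h2 g h]
  rw [Nat.card_congr Equiv.subtypePiEquivPi, Nat.card_pi, Finset.prod_congr rfl fun g _ => h3 g,
    Finset.prod_ite, Finset.prod_const_one, one_mul, Finset.prod_const, Finset.filter_not,
    Finset.card_sdiff_of_subset (Finset.filter_subset _ _), Finset.card_univ,
    Nat.card_eq_fintype_card, Nat.card_eq_fintype_card, Fintype.card_subtype]

namespace C5

theorem card_retract_eq_half : Nat.card {c : C5.{u} // retract c = half} = 1 := by
  have h : {c : C5.{u} | retract c = half} = {⟨2⟩} := by
    ext ⟨c⟩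
    have h1 : retract ⟨c⟩ = half.{u} ↔ ![(0 : Fin 5), 0, 2, 4, 4] c = 2 :=
      ⟨fun h => congrArg num h, fun h => ext_num h⟩
    have h2 : (⟨c⟩ : C5.{u}) = ⟨2⟩ ↔ c = 2 := ⟨fun h => congrArg num h, fun h => ext_num h⟩
    rw [Set.mem_ofPred_eq, Set.mem_singleton_iff, h1, h2]
    clear h1 h2
    revert c; decide
  exact (Nat.card_congr (Equiv.setCongr h)).trans (by simp)

theorem card_retract_eq {a : C5.{u}} (ha : a = zero ∨ a = one) :
    Nat.card {c : C5.{u} // retract c = a} = 2 := by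
  have hne : ∀ i j : Fin 5, i ≠ j → (⟨i⟩ : C5.{u}) ≠ ⟨j⟩ := fun i j h e => h (congrArg num e)
  have h : ∃ i j : Fin 5, i ≠ j ∧ {c : C5.{u} | retract c = a} = {⟨i⟩, ⟨j⟩} := by
    have h1 : ∀ c d : Fin 5, retract ⟨c⟩ = (⟨d⟩ : C5.{u}) ↔ ![(0 : Fin 5), 0, 2, 4, 4] c = d :=
      fun c d => ⟨fun h => congrArg num h, fun h => ext_num h⟩
    have h2 : ∀ c d : Fin 5, (⟨c⟩ : C5.{u}) = ⟨d⟩ ↔ c = d :=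
      fun c d => ⟨fun h => congrArg num h, fun h => ext_num h⟩
    rcases ha with rfl | rfl
    · refine ⟨0, 1, by decide, ?_⟩
      ext ⟨c⟩
      rw [Set.mem_ofPred_eq, Set.mem_insert_iff, Set.mem_singleton_iff, zero, h1, h2, h2]
      clear h1 h2 hne
      revert c; decide
    · refine ⟨3, 4, by decide, ?_⟩
      ext ⟨c⟩
      rw [Set.mem_ofPred_eq, Set.mem_insert_iff, Set.mem_singleton_iff, one, h1, h2, h2]
      clear h1 h2 hne
      revert c; decide
  obtain ⟨i, j, hij, h⟩ := h
  exact (Nat.card_coe_set_eq {c : C5.{u} | retract c = a}).trans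
    (by rw [h, Set.ncard_pair (hne i j hij)])

theorem card_zero_or_one : Nat.card {c : C5.{u} // c = zero ∨ c = one} = 2 :=
  (Nat.card_coe_set_eq {c : C5.{u} | c = zero ∨ c = one}).trans
    (Set.ncard_pair fun h => absurd (congrArg num h) (by decide))

end C5

theorem ThreeValuedFun.halves_eq_zero_iff {F : Type u} {G : Set F} [Finite G]
    (f : ThreeValuedFun G) : f.halves = 0 ↔ ∀ g, f.1 g = C5.zero ∨ f.1 g = C5.one := by
  rw [halves, Finite.card_eq_zero_iff, isEmpty_subtype]
  refine forall_congr' fun g => ?_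
  have hz : C5.zero.{u} ≠ C5.half := fun h => absurd (congrArg C5.num h) (by decide)
  have ho : C5.one.{u} ≠ C5.half := fun h => absurd (congrArg C5.num h) (by decide)
  constructor
  · intro h
    rcases f.2 g with h1 | h1 | h1
    exacts [Or.inl h1, absurd h1 h, Or.inr h1]
  · rintro (h | h) <;> rw [h]
    exacts [hz, ho]

/-- The number of three-valued functions with `k` values `1/2`. -/
theorem ThreeValuedFun.card_halves_eq {F : Type u} {G : Set F} [Finite G] (k : ℕ) :
    Nat.card {f : ThreeValuedFun G // f.halves = k} =
      (Nat.card G).choose k * 2 ^ (Nat.card G - k) := by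
  classical
  have := Fintype.ofFinite G
  have : Finite C5.{u} := Finite.of_injective C5.num fun _ _ => C5.ext_num
  have : Finite (ThreeValuedFun G) := Subtype.finite
  have := Fintype.ofFinite (ThreeValuedFun G)
  let half : ThreeValuedFun G → Finset G := fun f => {g | f.1 g = C5.half}
  have hcard : ∀ f : ThreeValuedFun G, (half f).card = f.halves := fun f => by
    rw [halves, Nat.card_eq_fintype_card, Fintype.card_subtype]
  have hz : C5.zero.{u} ≠ C5.half := fun h => absurd (congrArg C5.num h) (by decide)
  have ho : C5.one.{u} ≠ C5.half := fun h => absurd (congrArg C5.num h) (by decide)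
  have hfib : ∀ S : Finset G, Nat.card {f : ThreeValuedFun G // half f = S} =
      2 ^ (Nat.card G - S.card) := by
    intro S
    let p : G → C5.{u} → Prop := fun g c =>
      if g ∈ S then c = C5.half else c = C5.zero ∨ c = C5.one
    have h1 : Nat.card {f : ThreeValuedFun G // half f = S} =
        Nat.card {h : G → C5.{u} // ∀ g, p g (h g)} := by
      refine Nat.card_congr
        { toFun := fun f => ⟨f.1.1, fun g => ?_⟩
          invFun := fun h => ⟨⟨h.1, fun g => ?_⟩, ?_⟩
          left_inv := fun _ => rfl
          right_inv := fun _ => rfl }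
      · have h2 : g ∈ half f.1 ↔ f.1.1 g = C5.half := by simp [half]
        rw [f.2] at h2
        simp only [p]
        split_ifs with h
        · exact h2.1 h
        · rcases f.1.2 g with h3 | h3 | h3
          exacts [Or.inl h3, absurd (h2.2 h3) h, Or.inr h3]
      · have h2 := h.2 g
        simp only [p] at h2
        split_ifs at h2
        exacts [Or.inr (Or.inl h2), h2.imp_right Or.inr]
      · ext g
        have h2 := h.2 g
        simp only [p] at h2
        simp only [half, Finset.mem_filter, Finset.mem_univ, true_and]
        split_ifs at h2 with hg
        · exact ⟨fun _ => hg, fun _ => h2⟩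
        · refine ⟨fun h3 => ?_, fun h3 => absurd h3 hg⟩
          rw [h3] at h2
          exact (h2.elim (fun h => hz h.symm) fun h => ho h.symm).elim
    rw [h1, Nat.card_pi_subtype_one_two (S : Set G)]
    · simp
    · intro g hg
      simp only [p, if_pos (Finset.mem_coe.1 hg)]
      exact Nat.card_unique
    · intro g hg
      simp only [p, if_neg fun h => hg (Finset.mem_coe.2 h)]
      exact C5.card_zero_or_one
  rw [Nat.card_eq_fintype_card, Fintype.card_subtype,
    Finset.card_eq_sum_card_fiberwise (f := half) (t := Finset.univ.powersetCard k) (by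
      intro f hf
      simp only [Finset.coe_filter, Finset.mem_univ, true_and, Set.mem_ofPred_eq] at hf
      simp [hcard, hf])]
  rw [Finset.sum_congr rfl (g := fun _ => 2 ^ (Nat.card G - k)), Finset.sum_const,
    Finset.card_powersetCard, Finset.card_univ, smul_eq_mul, Nat.card_eq_fintype_card]
  intro S hS
  rw [Finset.mem_powersetCard] at hS
  rw [← hS.2, ← hfib S, Nat.card_eq_fintype_card, Fintype.card_subtype, Finset.filter_filter]
  congr 1
  ext f
  simp only [Finset.mem_filter, Finset.mem_univ, true_and, and_iff_right_iff_imp]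
  rintro rfl
  exact (hcard f).symm

namespace IsFreeGeneratingSet

open InvolutivePoset PrimeFilter

variable {F : Type u} [NelsonOps F] [IsFiveValuedNelson F] {G : Set F}
  (hG : IsFreeGeneratingSet G)

/-- The point `P_f` of its own component. -/
noncomputable def basePoint (f : ThreeValuedFun G) : Component (hG.kerFilter f.1) :=
  ⟨hG.kerFilter f.1, .refl _⟩

theorem basePoint_le_φ (f : ThreeValuedFun G) : hG.basePoint f ≤ φ (hG.basePoint f) :=
  hG.kerFilter_le_φ f.1

theorem exists_kerFilter_eq_of_component {f : ThreeValuedFun G}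
    (Q : Component (hG.kerFilter f.1)) : ∃ f' : G → C5.{u},
      (fun g => C5.retract (f' g)) = f.1 ∧ (Q.1 = hG.kerFilter f' ∨ Q.1 = φ (hG.kerFilter f')) := by
  obtain ⟨f', e⟩ := hG.exists_kerFilter_eq Q.1
  refine ⟨f', hG.eqvGen_kerFilter_retract_iff.1 (.trans _ _ _ Q.2 ?_), e⟩
  rcases e with e | e <;> rw [e]
  · exact .refl _
  · exact .symm _ _ (Component.eqvGen_φ _)

theorem le_basePoint_or (f : ThreeValuedFun G) (Q : Component (hG.kerFilter f.1)) :
    Q ≤ hG.basePoint f ∨ φ (hG.basePoint f) ≤ Q := by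
  obtain ⟨f', h, e⟩ := hG.exists_kerFilter_eq_of_component Q
  have h1 := hG.kerFilter_le_kerFilter_retract f'
  rw [h] at h1
  rcases e with e | e
  · exact Or.inl (show Q.1 ≤ hG.kerFilter f.1 by rwa [e])
  · exact Or.inr (show φ (hG.kerFilter f.1) ≤ Q.1 by rw [e]; exact φ_anti _ _ h1)

theorem exists_kerFilter_eq_of_le_basePoint {f : ThreeValuedFun G}
    {Q : Component (hG.kerFilter f.1)} (hQ : Q ≤ hG.basePoint f) : ∃ f' : G → C5.{u},
      (fun g => C5.retract (f' g)) = f.1 ∧ Q.1 = hG.kerFilter f' := by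
  obtain ⟨f', h, e⟩ := hG.exists_kerFilter_eq_of_component Q
  refine ⟨f', h, e.elim id fun e => ?_⟩
  have h1 : φ (hG.kerFilter f') ≤ hG.kerFilter f.1 := e ▸ (show Q.1 ≤ hG.kerFilter f.1 from hQ)
  have h2 : hG.kerFilter f' ≤ hG.kerFilter f.1 := by
    rw [← h]; exact hG.kerFilter_le_kerFilter_retract f'
  have h3 := hG.kerFilter_le_φ f.1
  rw [e, le_antisymm h1 (h3.trans (φ_anti _ _ h2))]
  exact le_antisymm (h3.trans (φ_le_comm.1 h1)) h2

theorem eq_of_le_of_lt_basePoint {f : ThreeValuedFun G} {Q R : Component (hG.kerFilter f.1)}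
    (hQR : Q ≤ R) (hR : R < hG.basePoint f) : Q = R := by
  obtain ⟨f', -, e⟩ := hG.exists_kerFilter_eq_of_le_basePoint (hQR.trans hR.le)
  obtain ⟨k, hk, e'⟩ := hG.exists_kerFilter_eq_of_le_basePoint hR.le
  by_contra hne
  have hlt : hG.kerFilter f' < hG.kerFilter k := by
    rw [← e, ← e']
    exact lt_of_le_of_ne hQR fun h => hne (Subtype.ext h)
  refine hR.ne (Subtype.ext ?_)
  rw [e']
  change _ = hG.kerFilter f.1
  rw [← hk]
  congr 1
  funext g
  rw [← hG.extend_apply k]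
  exact (retract_comp_eq_of_ker_lt hlt _).symm

theorem card_Iic_basePoint [Finite G] (f : ThreeValuedFun G) :
    Nat.card (Set.Iic (hG.basePoint f)) = 2 ^ (Nat.card G - f.halves) := by
  have h1 : Nat.card {h : G → C5.{u} // ∀ g, C5.retract (h g) = f.1 g} =
      2 ^ (Nat.card G - f.halves) := by
    refine Nat.card_pi_subtype_one_two (p := fun g c => C5.retract c = f.1 g)
      {g | f.1 g = C5.half} (fun g hg => ?_) fun g hg => ?_
    · rw [show f.1 g = C5.half from hg]
      exact C5.card_retract_eq_half
    · refine C5.card_retract_eq ?_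
      rcases f.2 g with h | h | h
      exacts [Or.inl h, absurd h hg, Or.inr h]
  rw [← h1]
  have hle : ∀ h : {h : G → C5.{u} // ∀ g, C5.retract (h g) = f.1 g},
      hG.kerFilter h.1 ≤ hG.kerFilter f.1 := fun h => by
    have h2 := hG.kerFilter_le_kerFilter_retract h.1
    rwa [funext h.2] at h2
  refine (Nat.card_eq_of_bijective (fun h : {h : G → C5.{u} // ∀ g, C5.retract (h g) = f.1 g} =>
    (⟨⟨hG.kerFilter h.1, hG.eqvGen_kerFilter_retract_iff.2 (funext h.2)⟩,
      show hG.kerFilter h.1 ≤ hG.kerFilter f.1 from hle h⟩ : Set.Iic (hG.basePoint f)))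
    ⟨?_, ?_⟩).symm
  · intro h h' e
    exact Subtype.ext (hG.kerFilter_injective (congrArg (fun Q => Q.1.1) e))
  · rintro ⟨Q, hQ⟩
    obtain ⟨f', h, e⟩ := hG.exists_kerFilter_eq_of_le_basePoint hQ
    exact ⟨⟨f', fun g => congrFun h g⟩, Subtype.ext (Subtype.ext e.symm)⟩

/-- The base point is fixed by the involution exactly when `f` omits the value `1/2`. -/
theorem φ_basePoint_eq_iff [Finite G] (f : ThreeValuedFun G) :
    φ (hG.basePoint f) = hG.basePoint f ↔ f.halves = 0 := by
  rw [ThreeValuedFun.halves_eq_zero_iff]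
  have h0 : φ (hG.basePoint f) = hG.basePoint f ↔
      ∀ x : F, 1 ≤ (hG.extend f.1 x).num ↔ 4 ≤ (hG.extend f.1 x).num := by
    simp only [← hG.mem_kerFilter, ← hG.mem_φ_kerFilter]
    exact ⟨fun h x => Set.ext_iff.1 (congrArg (fun Q => Q.1.carrier) h) x,
      fun h => Subtype.ext (PrimeFilter.ext (Set.ext h))⟩
  rw [h0]
  constructor
  · intro h g
    have h1 := h g.1
    rw [hG.extend_apply] at h1
    rcases f.2 g with h2 | h2 | h2
    · exact Or.inl h2
    · rw [h2] at h1
      exact absurd h1 (by decide)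
    · exact Or.inr h2
  · intro h
    have hh := hG.isNelsonHom_extend f.1
    have hS := hG.generates {x | hG.extend f.1 x = C5.zero ∨ hG.extend f.1 x = C5.one}
      { one_mem := Or.inr hh.map_one
        neg_mem := fun x hx => by
          rw [Set.mem_ofPred_eq, hh.map_neg]
          rcases hx with hx | hx <;> rw [hx]
          exacts [Or.inr rfl, Or.inl rfl]
        inf_mem := fun x hx y hy => by
          rw [Set.mem_ofPred_eq, hh.map_inf]
          rcases hx with hx | hx <;> rcases hy with hy | hy <;> rw [hx, hy]
          exacts [Or.inl rfl, Or.inl rfl, Or.inl rfl, Or.inr rfl]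
        sup_mem := fun x hx y hy => by
          rw [Set.mem_ofPred_eq, hh.map_sup]
          rcases hx with hx | hx <;> rcases hy with hy | hy <;> rw [hx, hy]
          exacts [Or.inl rfl, Or.inr rfl, Or.inr rfl, Or.inr rfl]
        imp_mem := fun x hx y hy => by
          rw [Set.mem_ofPred_eq, hh.map_imp]
          rcases hx with hx | hx <;> rcases hy with hy | hy <;> rw [hx, hy]
          exacts [Or.inr rfl, Or.inr rfl, Or.inl rfl, Or.inr rfl] }
      fun g hg => by
        rw [Set.mem_ofPred_eq, hG.extend_apply f.1 ⟨g, hg⟩]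
        exact h ⟨g, hg⟩
    intro x
    have hx : x ∈ {x | hG.extend f.1 x = C5.zero ∨ hG.extend f.1 x = C5.one} :=
      hS.symm ▸ Set.mem_univ x
    rcases hx with hx | hx <;> rw [hx] <;> decide

theorem card_factor [Finite G] (f : ThreeValuedFun G) : Nat.card (hG.Factor f) =
    2 ^ 2 ^ (Nat.card G - f.halves) + if f.halves = 0 then 0 else 1 := by
  have := hG.finite_primeFilter
  have : Finite (Component (hG.kerFilter f.1)) := Subtype.finite
  rw [UpSets.card_of_antichain (hG.basePoint_le_φ f) (hG.le_basePoint_or f)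
    (fun _ _ => hG.eq_of_le_of_lt_basePoint), hG.card_Iic_basePoint]
  congr 1
  rw [ne_eq, hG.φ_basePoint_eq_iff]
  split_ifs with h <;> simp [h]

theorem card_eq (hG : IsFreeGeneratingSet G) [Finite G] : Nat.card F = 2 ^ 2 ^ (2 * Nat.card G) *
    ∏ k ∈ Finset.Icc 1 (Nat.card G), (2 ^ 2 ^ (Nat.card G - k) + 1) ^
      ((Nat.card G).choose k * 2 ^ (Nat.card G - k)) := by
  classical
  have : Finite C5.{u} := Finite.of_injective C5.num fun _ _ => C5.ext_num
  have : Finite (ThreeValuedFun G) := Subtype.finite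
  have := Fintype.ofFinite (ThreeValuedFun G)
  set n := Nat.card G with hn
  let c : ℕ → ℕ := fun k => 2 ^ 2 ^ (n - k) + if k = 0 then 0 else 1
  have h1 : ∏ f : ThreeValuedFun G, c f.halves =
      ∏ k ∈ Finset.range (n + 1), c k ^ (n.choose k * 2 ^ (n - k)) := by
    rw [← Finset.prod_fiberwise_of_maps_to (g := ThreeValuedFun.halves) (t := Finset.range (n + 1))
      fun f _ => Finset.mem_range_succ_iff.2 (Finite.card_subtype_le _)]
    refine Finset.prod_congr rfl fun k _ => ?_
    rw [← ThreeValuedFun.card_halves_eq, Nat.card_eq_fintype_card, Fintype.card_subtype,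
      Finset.prod_congr rfl fun f hf => congrArg c (Finset.mem_filter.1 hf).2, Finset.prod_const]
  rw [Nat.card_eq_of_bijective _ hG.bijective_toFactors, Nat.card_pi,
    Finset.prod_congr rfl fun f _ => hG.card_factor f, h1, Finset.prod_range_succ', mul_comm]
  congr 1
  · simp only [c, if_pos, Nat.choose_zero_right, one_mul, Nat.sub_zero, add_zero]
    rw [← pow_mul, ← pow_add, two_mul]
  · rw [← Finset.Ico_succ_right_eq_Icc, Finset.prod_Ico_eq_prod_range]
    refine Finset.prod_congr (by simp) fun k _ => ?_
    simp only [c, if_neg (Nat.succ_ne_zero k), Nat.add_comm 1 k]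

end IsFreeGeneratingSet

theorem mainTheorem1 (n : ℕ) (hn : 1 ≤ n) :
    (∃ (F : Type u) (_ : NelsonOps F) (_ : IsFiveValuedNelson F) (G : Set F),
      IsFreeGeneratingSet G ∧ Cardinal.mk G = n) ∧
    ∀ (F : Type u) [NelsonOps F] [IsFiveValuedNelson F] (G : Set F)
      (hG : IsFreeGeneratingSet G), Cardinal.mk G = n →
      (∀ Q : PrimeFilter F, ∃! f : ThreeValuedFun G,
        Relation.EqvGen (· ≤ ·) (hG.kerFilter f.1) Q) ∧
      (∀ f : ThreeValuedFun G, IsFiveValuedNelson (hG.Factor f)) ∧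
      (∃ Φ : F → ∀ f : ThreeValuedFun G, hG.Factor f,
        Function.Bijective Φ ∧ IsNelsonHom Φ) ∧
      (∀ f : ThreeValuedFun G, (∀ g, f.1 g = C5.zero ∨ f.1 g = C5.one) →
        Nat.card (hG.Factor f) = 2 ^ 2 ^ n) ∧
      (∀ f : ThreeValuedFun G, 1 ≤ f.halves →
        Nat.card (hG.Factor f) = 2 ^ 2 ^ (n - f.halves) + 1) ∧
      Finite F ∧
      Nat.card F = 2 ^ 2 ^ (2 * n) *
        ∏ k ∈ Finset.Icc 1 n, (2 ^ 2 ^ (n - k) + 1) ^ (n.choose k * 2 ^ (n - k)) := by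
  refine ⟨exists_isFreeGeneratingSet n, fun F _ _ G hG hcard => ?_⟩
  have hfin : Finite G := by
    rw [← Cardinal.lt_aleph0_iff_finite, hcard]
    exact Cardinal.natCast_lt_aleph0
  have hn' : Nat.card G = n := by rw [Nat.card, hcard, Cardinal.toNat_natCast]
  subst hn'
  have hF := hG.card_eq
  refine ⟨hG.existsUnique_eqvGen, hG.isFiveValuedNelson_factor,
    ⟨_, hG.bijective_toFactors, hG.isNelsonHom_toFactors⟩, fun f hf => ?_, fun f hf => ?_, ?_, hF⟩
  · rw [hG.card_factor, if_pos (f.halves_eq_zero_iff.2 hf), f.halves_eq_zero_iff.2 hf,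
      Nat.sub_zero, add_zero]
  · rw [hG.card_factor, if_neg (Nat.one_le_iff_ne_zero.1 hf)]
  · refine Nat.finite_of_card_ne_zero (hF ▸ ?_)
    positivity
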